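/- Let $N$ be a free abelian group of finite rank $n$, let $M=\mathrm{Hom}_{\mathbb Z}(N,\mathbb Z)$ and $N_{\mathbb R}=\mathbb R\otimes_{\mathbb Z}N$, and let $\Sigma$ be a fan in $N_{\mathbb R}$, that is, a finite collection of strongly convex rational polyhedral cones which contains every face of each of its members and in which any two members intersect in a common face. Let $X_\Sigma$ be the associated complex toric variety with its analytic topology, obtained by gluing the affine charts $U_\sigma=\mathrm{Spec}\,\mathbb C[\sigma^\vee\cap M]$, $\sigma\in\Sigma$, along the charts of intersections of cones; a point of $U_\sigma$ is a homomorphism $\gamma:\sigma^\vee\cap M\to(\mathbb C,\cdot)$ of semigroups with unit. For $\sigma\in\Sigma$ let $z_\sigma\in U_\sigma$ be the distinguished point, which takes the value $1$ on $\sigma^\perp\cap M$ and $0$ elsewhere, and let $\mathcal O(\sigma)$ be its orbit under the torus $T_N=\mathbb C^*\otimes_{\mathbb Z}N$. Let $N_\sigma\subseteq N$ be the subgroup generated by $\sigma\cap N$ and put $N(\sigma)=N/N_\sigma$, so that $t\mapsto t\cdot z_\sigma$ identifies $T_{N(\sigma)}=\mathbb C^*\otimes_{\mathbb Z}N(\sigma)$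 with $\mathcal O(\sigma)$. The distinguished compact torus of $\mathcal O(\sigma)$ is $S(\sigma)=S_{N(\sigma)}\cdot z_\sigma$, where $S_{N(\sigma)}=S^1\otimes_{\mathbb Z}N(\sigma)$, and $\mu(S(\sigma))$ denotes the normalised Haar measure on it (the image under $s\mapsto s\cdot z_\sigma$ of the Haar probability measure of $S_{N(\sigma)}$), regarded as a measure on $X_\Sigma$. For a positive integer $m$ let $\Phi_m:X_\Sigma\to X_\Sigma$ be the toric endomorphism induced by the multiplication map $N\to N$, $v\mapsto mv$, and for $z\in X_\Sigma$ let $$\Phi_m^*(\delta_z)=\sum_{a\in X_\Sigma,\ \Phi_m(a)=z}\delta_a .$$ Then for every $\sigma\in\Sigma$ and every $z\in\mathcal O(\sigma)$, $$m^{\dim(\sigma)-n}\,\Phi_m^*(\delta_z)\longrightarrow\mu(S(\sigma))\qquad\text{as } m\to\infty$$ weakly as finite measures on $X_\Sigma$, i.e. the measures on the left are finite for all large $m$ and their integrals of every bounded continuous function on $X_\Sigma$ converge to its integral against $\mu(S(\sigma))$. -/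

import Mathlib

open MeasureTheory Filter Topology TensorProduct
open scoped NNReal ENNReal

namespace Toric

section Cones

variable {N : Type*} [AddCommGroup N]

/-- The pairing `⟨u, v⟩` of `u ∈ M = Hom(N, ℤ)` with `v ∈ N_ℝ = ℝ ⊗ N`. -/
noncomputable def pairing (u : Module.Dual ℤ N) (v : ℝ ⊗[ℤ] N) : ℝ :=
  Module.Dual.baseChange ℝ u v

/-- A rational polyhedral cone: one generated by finitely many points of the lattice `N`. -/
def IsRationalPolyhedral (σ : PointedCone ℝ (ℝ ⊗[ℤ] N)) : Prop :=
  ∃ S : Finset N, σ = PointedCone.hull ℝ ((fun v : N => (1 : ℝ) ⊗ₜ[ℤ] v) '' (S : Set N))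

/-- `τ` is a face of `σ`: it is cut out of `σ` by a supporting hyperplane, i.e. by a linear form
which is nonnegative on `σ` (the zero form gives `σ` itself). -/
def IsFace (τ σ : PointedCone ℝ (ℝ ⊗[ℤ] N)) : Prop :=
  ∃ u : Module.Dual ℝ (ℝ ⊗[ℤ] N), (∀ v ∈ σ, 0 ≤ u v) ∧ ∀ v, v ∈ τ ↔ v ∈ σ ∧ u v = 0

/-- The dimension of a cone is the dimension of its real linear span. -/
noncomputable def coneDim (σ : PointedCone ℝ (ℝ ⊗[ℤ] N)) : ℕ :=
  Module.finrank ℝ (Submodule.span ℝ (σ : Set (ℝ ⊗[ℤ] N)))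

/-- The semigroup `σ^∨ ∩ M`. -/
noncomputable def dualSemigroup (σ : PointedCone ℝ (ℝ ⊗[ℤ] N)) :
    AddSubmonoid (Module.Dual ℤ N) where
  carrier := {u | ∀ v ∈ σ, 0 ≤ pairing u v}
  zero_mem' := by intro v _; simp [pairing]
  add_mem' := by
    intro a b ha hb v hv
    simpa [pairing] using add_nonneg (ha v hv) (hb v hv)

/-- The lattice `σ^⊥ ∩ M`. -/
noncomputable def perp (σ : PointedCone ℝ (ℝ ⊗[ℤ] N)) : AddSubgroup (Module.Dual ℤ N) where
  carrier := {u | ∀ v ∈ σ, pairing u v = 0}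
  zero_mem' := by intro v _; simp [pairing]
  add_mem' := by
    intro a b ha hb v hv
    have h1 := ha v hv
    have h2 := hb v hv
    simp only [pairing] at h1 h2
    simp [pairing, h1, h2]
  neg_mem' := by
    intro a ha v hv
    have h1 := ha v hv
    simp only [pairing] at h1
    simp [pairing, h1]

/-- The sublattice `N_σ` of `N` spanned by the points of `σ ∩ N`. -/
def latticeSpan (σ : PointedCone ℝ (ℝ ⊗[ℤ] N)) : Submodule ℤ N :=
  Submodule.span ℤ {v : N | (1 : ℝ) ⊗ₜ[ℤ] v ∈ σ}

/-- The quotient lattice `N(σ) = N / N_σ`. -/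
abbrev QuotLattice (σ : PointedCone ℝ (ℝ ⊗[ℤ] N)) : Type _ := N ⧸ latticeSpan σ

theorem latticeSpan_le_ker {σ : PointedCone ℝ (ℝ ⊗[ℤ] N)} {u : Module.Dual ℤ N}
    (hu : u ∈ perp σ) : latticeSpan σ ≤ LinearMap.ker u := by
  refine Submodule.span_le.2 fun v hv => ?_
  have h := hu _ hv
  simpa [pairing, Module.Dual.baseChange_apply_tmul] using h

/-- An element of `σ^⊥ ∩ M`, seen as a linear form on `N(σ)`. -/
def descend {σ : PointedCone ℝ (ℝ ⊗[ℤ] N)} (u : Module.Dual ℤ N) (hu : u ∈ perp σ) :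
    Module.Dual ℤ (QuotLattice σ) :=
  (latticeSpan σ).liftQ u (latticeSpan_le_ker hu)

theorem add_mem_perp_iff {σ : PointedCone ℝ (ℝ ⊗[ℤ] N)} {a b : Module.Dual ℤ N}
    (ha : a ∈ dualSemigroup σ) (hb : b ∈ dualSemigroup σ) :
    a + b ∈ perp σ ↔ a ∈ perp σ ∧ b ∈ perp σ := by
  refine ⟨fun h => ?_, fun h => add_mem h.1 h.2⟩
  have key : ∀ v ∈ σ, pairing a v = 0 ∧ pairing b v = 0 := by
    intro v hv
    have h1 := h v hv
    have h2 := ha v hv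
    have h3 := hb v hv
    have h4 : pairing (a + b) v = pairing a v + pairing b v := by simp [pairing]
    constructor <;> linarith
  exact ⟨fun v hv => (key v hv).1, fun v hv => (key v hv).2⟩

end Cones

section Tori

/-- The character `χ^u : G ⊗ L → G`, `g ⊗ v ↦ g ^ ⟨u, v⟩`, for a commutative group `G` (written
multiplicatively), a lattice `L`, and `u ∈ Hom(L, ℤ)`. -/
noncomputable def character (G : Type*) [CommGroup G] {L : Type*} [AddCommGroup L]
    (u : Module.Dual ℤ L) (t : Additive G ⊗[ℤ] L) : G :=
  (TensorProduct.rid ℤ (Additive G) (u.lTensor (Additive G) t)).toMul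

theorem character_tmul {G : Type*} [CommGroup G] {L : Type*} [AddCommGroup L]
    (u : Module.Dual ℤ L) (g : G) (v : L) :
    character G u (Additive.ofMul g ⊗ₜ[ℤ] v) = g ^ (u v) := by
  simp [character]

theorem character_add_left {G : Type*} [CommGroup G] {L : Type*} [AddCommGroup L]
    (u u' : Module.Dual ℤ L) (t : Additive G ⊗[ℤ] L) :
    character G (u + u') t = character G u t * character G u' t := by
  simp [character, LinearMap.lTensor_add]

theorem character_zero_left {G : Type*} [CommGroup G] {L : Type*} [AddCommGroup L]
    (t : Additive G ⊗[ℤ] L) : character G (0 : Module.Dual ℤ L) t = 1 := by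
  simp [character]

theorem character_add_right {G : Type*} [CommGroup G] {L : Type*} [AddCommGroup L]
    (u : Module.Dual ℤ L) (t t' : Additive G ⊗[ℤ] L) :
    character G u (t + t') = character G u t * character G u t' := by
  simp [character]

theorem character_neg_right {G : Type*} [CommGroup G] {L : Type*} [AddCommGroup L]
    (u : Module.Dual ℤ L) (t : Additive G ⊗[ℤ] L) :
    character G u (-t) = (character G u t)⁻¹ := by
  simp [character]

theorem character_zero_right {G : Type*} [CommGroup G] {L : Type*} [AddCommGroup L]
    (u : Module.Dual ℤ L) : character G u 0 = 1 := by
  simp [character]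

/-- The complex torus `T_L = ℂ^* ⊗ L`. -/
abbrev ComplexTorus (L : Type*) [AddCommGroup L] : Type _ := Additive ℂˣ ⊗[ℤ] L

/-- The compact torus `S_L = S^1 ⊗ L`. -/
def CompactTorus (L : Type*) [AddCommGroup L] : Type _ := Additive Circle ⊗[ℤ] L

variable {L : Type*} [AddCommGroup L]

noncomputable instance : AddCommGroup (CompactTorus L) :=
  inferInstanceAs (AddCommGroup (Additive Circle ⊗[ℤ] L))

/-- All characters of the compact torus taken together. -/
noncomputable def allCharacters (L : Type*) [AddCommGroup L] :
    CompactTorus L → (Module.Dual ℤ L → Circle) := fun s u => character Circle u s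

/-- The topology of `S_L` is the coarsest one for which all characters are continuous; for
`L ≅ ℤ^q` it is the topology of `(S^1)^q`. -/
noncomputable instance : TopologicalSpace (CompactTorus L) :=
  TopologicalSpace.induced (allCharacters L) inferInstance

theorem continuous_character (u : Module.Dual ℤ L) :
    Continuous (fun s : CompactTorus L => character Circle u s) :=
  (continuous_apply u).comp (continuous_induced_dom (f := allCharacters L))

theorem continuous_compactTorus_iff {Y : Type*} [TopologicalSpace Y] {f : Y → CompactTorus L} :
    Continuous f ↔ ∀ u : Module.Dual ℤ L, Continuous fun y => character Circle u (f y) := by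
  rw [continuous_induced_rng, continuous_pi_iff]
  rfl

instance : IsTopologicalAddGroup (CompactTorus L) where
  continuous_add := by
    refine continuous_compactTorus_iff.2 fun u => ?_
    have h : (fun y : CompactTorus L × CompactTorus L => character Circle u (y.1 + y.2))
        = fun y => character Circle u y.1 * character Circle u y.2 :=
      funext fun y => character_add_right u _ _
    rw [h]
    exact ((continuous_character u).comp continuous_fst).mul
      ((continuous_character u).comp continuous_snd)
  continuous_neg := by
    refine continuous_compactTorus_iff.2 fun u => ?_
    have h : (fun y : CompactTorus L => character Circle u (-y))
        = fun y => (character Circle u y)⁻¹ := funext fun y => character_neg_right u _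
    rw [h]
    exact (continuous_character u).inv

instance [Module.Finite ℤ L] : CompactSpace (CompactTorus L) := by
  obtain ⟨k, b, hb⟩ := Module.Finite.exists_fin (R := ℤ) (M := L)
  let f : (Fin k → Circle) → Additive Circle ⊗[ℤ] L := fun z =>
    ∑ i, Additive.ofMul (z i) ⊗ₜ[ℤ] b i
  have hf : Continuous (fun z => show CompactTorus L from f z) := by
    refine continuous_compactTorus_iff.2 fun u => ?_
    have h : (fun z => character Circle u (f z)) = fun z => ∏ i, (z i) ^ (u (b i)) := by
      funext z
      simp [f, character]
    exact h ▸ continuous_finsetProd _ fun i _ => (continuous_apply i).zpow _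
  have hadd : ∀ z w, f (z * w) = f z + f w := by
    intro z w
    simp [f, TensorProduct.add_tmul, Finset.sum_add_distrib]
  have hsurj : Function.Surjective f := by
    intro s
    induction s using TensorProduct.induction_on with
    | zero => exact ⟨1, by simp [f]⟩
    | tmul g v =>
      have hv : v ∈ Submodule.span ℤ (Set.range b) := hb ▸ Submodule.mem_top
      obtain ⟨c, rfl⟩ := (Submodule.mem_span_range_iff_exists_fun ℤ).1 hv
      refine ⟨fun i => g.toMul ^ (c i), ?_⟩
      rw [TensorProduct.tmul_sum]
      exact Finset.sum_congr rfl fun i _ => TensorProduct.smul_tmul (c i) g (b i)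
    | add x y hx hy =>
      obtain ⟨z, rfl⟩ := hx
      obtain ⟨w, rfl⟩ := hy
      exact ⟨z * w, hadd z w⟩
  have h := isCompact_range hf
  exact ⟨hsurj.range_eq ▸ h⟩

noncomputable instance : MeasurableSpace (CompactTorus L) := borel _

instance : BorelSpace (CompactTorus L) := ⟨rfl⟩

/-- The normalised Haar measure of the compact group `S_L` (total mass one). -/
noncomputable def haarCompactTorus (L : Type*) [AddCommGroup L] [Module.Finite ℤ L] :
    Measure (CompactTorus L) :=
  Measure.addHaarMeasure ⊤

/-- The inclusion `S_L → T_L` induced by `S^1 ⊆ ℂ^*`. -/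
noncomputable def compactToComplex (s : CompactTorus L) : ComplexTorus L :=
  (MonoidHom.toAdditive Circle.toUnits).toIntLinearMap.rTensor L s

theorem character_compactToComplex (u : Module.Dual ℤ L) (s : CompactTorus L) :
    (character ℂˣ u (compactToComplex s) : ℂ) = character Circle u s := by
  have h : ∀ s : Additive Circle ⊗[ℤ] L,
      character ℂˣ u ((MonoidHom.toAdditive Circle.toUnits).toIntLinearMap.rTensor L s)
        = Circle.toUnits (character Circle u s) := by
    intro s
    induction s using TensorProduct.induction_on with
    | zero => simp [character]
    | tmul g v =>
      obtain ⟨g, rfl⟩ := Additive.ofMul.surjective g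
      simp only [LinearMap.rTensor_tmul, character_tmul, map_zpow]
      exact character_tmul _ _ _
    | add x y hx hy => rw [map_add, character_add_right, hx, hy, character_add_right, map_mul]
  exact congrArg Units.val (h s)

end Tori

section Charts

variable {N : Type*} [AddCommGroup N]

/-- The (complex points of the) affine toric variety `U_σ = Spec ℂ[σ^∨ ∩ M]`: a point is a
homomorphism of semigroups with unit from `σ^∨ ∩ M` (under addition) to `ℂ` (under
multiplication). -/
@[ext]
structure AffineChart (σ : PointedCone ℝ (ℝ ⊗[ℤ] N)) where
  /-- the value at the point of the monomial `χ^u`, `u ∈ σ^∨ ∩ M` -/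
  eval : dualSemigroup σ → ℂ
  eval_zero : eval 0 = 1
  eval_add : ∀ u u', eval (u + u') = eval u * eval u'

/-- The analytic topology of `U_σ`: the coarsest one for which all monomials are continuous. -/
noncomputable instance (σ : PointedCone ℝ (ℝ ⊗[ℤ] N)) : TopologicalSpace (AffineChart σ) :=
  TopologicalSpace.induced AffineChart.eval inferInstance

/-- The `ℂ`-points of `Spec ℂ[σ^∨ ∩ M]`, i.e. the `ℂ`-algebra homomorphisms `ℂ[σ^∨ ∩ M] → ℂ`,
are the points of `U_σ`. -/
noncomputable def AffineChart.equivPoints (σ : PointedCone ℝ (ℝ ⊗[ℤ] N)) :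
    AffineChart σ ≃ (AddMonoidAlgebra ℂ (dualSemigroup σ) →ₐ[ℂ] ℂ) :=
  Equiv.trans
    { toFun := fun γ =>
        { toFun := fun u => γ.eval u.toAdd
          map_one' := γ.eval_zero
          map_mul' := fun a b => γ.eval_add a.toAdd b.toAdd }
      invFun := fun g =>
        { eval := fun u => g (Multiplicative.ofAdd u)
          eval_zero := g.map_one
          eval_add := fun a b => g.map_mul (Multiplicative.ofAdd a) (Multiplicative.ofAdd b) }
      left_inv := fun _ => rfl
      right_inv := fun _ => rfl }
    (AddMonoidAlgebra.lift ℂ ℂ (dualSemigroup σ))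

theorem dualSemigroup_anti {τ σ : PointedCone ℝ (ℝ ⊗[ℤ] N)} (h : τ ≤ σ) :
    dualSemigroup σ ≤ dualSemigroup τ := fun _ hu v hv => hu v (h hv)

/-- The map `U_τ → U_σ` for `τ ⊆ σ`: restriction of semigroup homomorphisms from `τ^∨ ∩ M` to
`σ^∨ ∩ M`. If `τ` is a face of `σ` it is the inclusion of an open subset. -/
noncomputable def AffineChart.incl {τ σ : PointedCone ℝ (ℝ ⊗[ℤ] N)} (h : τ ≤ σ)
    (δ : AffineChart τ) : AffineChart σ where
  eval u := δ.eval (AddSubmonoid.inclusion (dualSemigroup_anti h) u)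
  eval_zero := by rw [map_zero, δ.eval_zero]
  eval_add a b := by rw [map_add, δ.eval_add]

/-- The action of `t ∈ T_N` on `U_σ`: `(t · γ)(u) = χ^u(t) γ(u)`. -/
noncomputable def AffineChart.act {σ : PointedCone ℝ (ℝ ⊗[ℤ] N)} (t : ComplexTorus N)
    (γ : AffineChart σ) : AffineChart σ where
  eval u := (character ℂˣ (u : Module.Dual ℤ N) t : ℂ) * γ.eval u
  eval_zero := by simp [γ.eval_zero, character_zero_left]
  eval_add a b := by
    simp only [γ.eval_add, AddSubmonoid.coe_add, character_add_left, Units.val_mul]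
    ring

open Classical in
/-- The distinguished point `z_σ` of `U_σ`. -/
noncomputable def distinguishedPoint (σ : PointedCone ℝ (ℝ ⊗[ℤ] N)) : AffineChart σ where
  eval u := if (u : Module.Dual ℤ N) ∈ perp σ then 1 else 0
  eval_zero := by simp [zero_mem]
  eval_add a b := by
    simp only [AddSubmonoid.coe_add, add_mem_perp_iff a.2 b.2]
    by_cases ha : (a : Module.Dual ℤ N) ∈ perp σ <;>
      by_cases hb : (b : Module.Dual ℤ N) ∈ perp σ <;> simp [ha, hb]

open Classical in
/-- The point `t · z_σ` for `t ∈ T_{N(σ)}`: a semigroup homomorphism which is `χ^u(t)` at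
`u ∈ σ^⊥ ∩ M = Hom(N(σ), ℤ)` and zero at all other `u`. -/
noncomputable def orbitPoint (σ : PointedCone ℝ (ℝ ⊗[ℤ] N))
    (t : ComplexTorus (QuotLattice σ)) : AffineChart σ where
  eval u := if h : (u : Module.Dual ℤ N) ∈ perp σ then
    (character ℂˣ (descend (u : Module.Dual ℤ N) h) t : ℂ) else 0
  eval_zero := by
    have h0 : (0 : Module.Dual ℤ N) ∈ perp σ := zero_mem _
    have h1 : descend 0 h0 = 0 := by
      ext v
      simp [descend]
    simp [h0, h1, character_zero_left]
  eval_add a b := by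
    simp only [AddSubmonoid.coe_add, add_mem_perp_iff a.2 b.2]
    by_cases ha : (a : Module.Dual ℤ N) ∈ perp σ
    · by_cases hb : (b : Module.Dual ℤ N) ∈ perp σ
      · have h1 : descend _ (add_mem ha hb) = descend _ ha + descend _ hb := by
          ext v
          simp [descend]
        simp [ha, hb, h1, character_add_left]
      · simp [ha, hb]
    · simp [ha]

/-- The action of `T_{N(σ)}` on `z_σ` is induced by the action of `T_N`. -/
theorem orbitPoint_mk (σ : PointedCone ℝ (ℝ ⊗[ℤ] N)) (t : ComplexTorus N) :
    orbitPoint σ ((latticeSpan σ).mkQ.lTensor (Additive ℂˣ) t)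
      = (distinguishedPoint σ).act t := by
  ext u
  by_cases h : (u : Module.Dual ℤ N) ∈ perp σ
  · have h1 : character ℂˣ (descend _ h) ((latticeSpan σ).mkQ.lTensor (Additive ℂˣ) t)
        = character ℂˣ (u : Module.Dual ℤ N) t := by
      have h2 : descend _ h ∘ₗ (latticeSpan σ).mkQ = (u : Module.Dual ℤ N) :=
        Submodule.liftQ_mkQ _ _ _
      simp only [character]
      rw [← LinearMap.comp_apply, ← LinearMap.lTensor_comp, h2]
    simp [orbitPoint, distinguishedPoint, AffineChart.act, h, h1]
  · simp [orbitPoint, distinguishedPoint, AffineChart.act, h]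

/-- A lattice endomorphism `φ` of `N` whose real extension maps `σ` to itself induces a map
`U_σ → U_σ`, `γ ↦ γ ∘ φ^*`. -/
noncomputable def AffineChart.mapEnd {σ : PointedCone ℝ (ℝ ⊗[ℤ] N)} (φ : N →ₗ[ℤ] N)
    (hφ : ∀ v ∈ σ, φ.baseChange ℝ v ∈ σ) (γ : AffineChart σ) : AffineChart σ where
  eval u := γ.eval ⟨(u : Module.Dual ℤ N) ∘ₗ φ, by
    intro v hv
    have h := u.2 _ (hφ v hv)
    have h1 : pairing ((u : Module.Dual ℤ N) ∘ₗ φ) v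
        = pairing (u : Module.Dual ℤ N) (φ.baseChange ℝ v) := by
      clear h hv
      simp only [pairing]
      induction v using TensorProduct.induction_on with
      | zero => simp
      | tmul x y => simp [Module.Dual.baseChange_apply_tmul]
      | add x y hx hy => simp only [map_add, hx, hy]
    rw [h1]
    exact h⟩
  eval_zero := by
    refine Eq.trans (congrArg γ.eval ?_) γ.eval_zero
    ext
    simp
  eval_add a b := by
    refine Eq.trans (congrArg γ.eval ?_) (γ.eval_add _ _)
    ext
    simp

end Charts

/-- A (rational polyhedral) fan in `N_ℝ`: a finite collection of strongly convex rational polyhedral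
cones which contains the faces of its members, and in which any two members meet in a common face. -/
structure Fan (N : Type*) [AddCommGroup N] where
  cones : Set (PointedCone ℝ (ℝ ⊗[ℤ] N))
  finite : cones.Finite
  rational : ∀ σ ∈ cones, IsRationalPolyhedral σ
  salient : ∀ σ ∈ cones, σ.toConvexCone.Salient
  face_mem : ∀ σ ∈ cones, ∀ τ, IsFace τ σ → τ ∈ cones
  inter_face : ∀ σ ∈ cones, ∀ τ ∈ cones, IsFace (σ ⊓ τ) σ ∧ IsFace (σ ⊓ τ) τ

namespace Fan

variable {N : Type*} [AddCommGroup N] (F : Fan N)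

/-- `x ∈ U_σ` and `y ∈ U_τ` are glued when they come from one point of `U_{σ ∩ τ}`. -/
def Glue (x y : Σ σ : F.cones, AffineChart (σ : PointedCone ℝ (ℝ ⊗[ℤ] N))) : Prop :=
  ∃ δ : AffineChart ((x.1 : PointedCone ℝ (ℝ ⊗[ℤ] N)) ⊓ (y.1 : PointedCone ℝ (ℝ ⊗[ℤ] N))),
    δ.incl inf_le_left = x.2 ∧ δ.incl inf_le_right = y.2

/-- The toric variety `X_Σ` (its complex points): the disjoint union of the charts `U_σ`, `σ ∈ Σ`,
with `U_σ` and `U_τ` glued along `U_{σ ∩ τ}`. -/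
def Variety : Type _ := Quot F.Glue

/-- The analytic topology of `X_Σ`: the quotient topology of the gluing. -/
instance : TopologicalSpace F.Variety := inferInstanceAs (TopologicalSpace (Quot F.Glue))

instance : MeasurableSpace F.Variety := borel _

instance : BorelSpace F.Variety := ⟨rfl⟩

/-- The chart `U_σ → X_Σ`. -/
def chart (σ : F.cones) (γ : AffineChart (σ : PointedCone ℝ (ℝ ⊗[ℤ] N))) : F.Variety :=
  Quot.mk _ ⟨σ, γ⟩

/-- The action of `T_N` on `X_Σ`. -/
noncomputable def act (t : ComplexTorus N) : F.Variety → F.Variety :=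
  Quot.map (fun x => ⟨x.1, x.2.act t⟩) (by
    rintro x y ⟨δ, h1, h2⟩
    exact ⟨δ.act t, by rw [← h1]; rfl, by rw [← h2]; rfl⟩)

/-- The orbit `O(σ)`: the `T_N`-orbit of the distinguished point `z_σ`. -/
def orbit (σ : F.cones) : Set F.Variety :=
  Set.range fun t : ComplexTorus N =>
    F.act t (F.chart σ (distinguishedPoint (σ : PointedCone ℝ (ℝ ⊗[ℤ] N))))

/-- The toric endomorphism of `X_Σ` induced by a lattice endomorphism `φ` of `N` whose real
extension maps every cone of `Σ` to itself. -/
noncomputable def toricEnd (φ : N →ₗ[ℤ] N) (hφ : ∀ σ ∈ F.cones, ∀ v ∈ σ, φ.baseChange ℝ v ∈ σ) :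
    F.Variety → F.Variety :=
  Quot.map (fun x => ⟨x.1, x.2.mapEnd φ (hφ _ x.1.2)⟩) (by
    rintro x y ⟨δ, h1, h2⟩
    exact ⟨δ.mapEnd φ (fun v hv => ⟨hφ _ x.1.2 v hv.1, hφ _ y.1.2 v hv.2⟩),
      by rw [← h1]; rfl, by rw [← h2]; rfl⟩)

theorem multiplication_mem (m : ℕ) (σ : PointedCone ℝ (ℝ ⊗[ℤ] N)) (v : ℝ ⊗[ℤ] N) (hv : v ∈ σ) :
    LinearMap.baseChange ℝ (m • (LinearMap.id : N →ₗ[ℤ] N)) v ∈ σ := by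
  have h : LinearMap.baseChange ℝ (m • (LinearMap.id : N →ₗ[ℤ] N)) v = m • v := by
    clear hv
    induction v using TensorProduct.induction_on with
    | zero => simp
    | tmul x y => simp [TensorProduct.tmul_smul]
    | add x y hx hy => rw [map_add, hx, hy, smul_add]
  rw [h]
  exact nsmul_mem hv m

/-- The toric endomorphism `Φ_m : X_Σ → X_Σ` induced by the multiplication map
`φ_m : N → N`, `v ↦ m v`. -/
noncomputable def multEnd (m : ℕ) : F.Variety → F.Variety :=
  F.toricEnd (m • LinearMap.id) fun σ _ v hv => multiplication_mem m σ v hv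

/-- The map `S_{N(σ)} → X_Σ`, `s ↦ s · z_σ`, whose image is the distinguished compact torus
`S(σ)` of `O(σ)`. -/
noncomputable def compactPoint (σ : F.cones)
    (s : CompactTorus (QuotLattice (σ : PointedCone ℝ (ℝ ⊗[ℤ] N)))) : F.Variety :=
  F.chart σ (orbitPoint (σ : PointedCone ℝ (ℝ ⊗[ℤ] N)) (compactToComplex s))

theorem continuous_compactPoint (σ : F.cones) : Continuous (F.compactPoint σ) := by
  have h1 : Continuous (F.chart σ) := continuous_quot_mk.comp continuous_sigmaMk
  refine h1.comp (continuous_induced_rng.2 (continuous_pi fun u => ?_))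
  simp only [Function.comp, orbitPoint]
  by_cases h : (u : Module.Dual ℤ N) ∈ perp (σ : PointedCone ℝ (ℝ ⊗[ℤ] N))
  · simp only [h, dite_true, character_compactToComplex]
    exact continuous_induced_dom.comp (continuous_character _)
  · simp only [h, dite_false]
    exact continuous_const

/-- The normalised Haar measure `μ(S(σ))` on the distinguished compact torus `S(σ)`, as a measure
on `X_Σ`: the normalised Haar measure of `S_{N(σ)}` transported by `s ↦ s · z_σ`. -/
noncomputable def haarDistinguished [Module.Finite ℤ N] (σ : F.cones) : Measure F.Variety :=
  (haarCompactTorus (QuotLattice (σ : PointedCone ℝ (ℝ ⊗[ℤ] N)))).map (F.compactPoint σ)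

end Fan

/-- The pullback `f^*(δ_z) = ∑_{f(a) = z} δ_a` of a Dirac measure. -/
noncomputable def pullbackDirac {X : Type*} [MeasurableSpace X] (f : X → X) (z : X) : Measure X :=
  Measure.sum fun a : f ⁻¹' {z} => Measure.dirac (a : X)

/-- Weak convergence `μ_m → μ` of measures: `μ` and, for all large `m`, the `μ_m` are finite, and
they converge in the weak topology of finite measures (integrals of bounded continuous functions
converge). -/
def WeaklyConverges {X : Type*} [MeasurableSpace X] [TopologicalSpace X] [OpensMeasurableSpace X]
    (μs : ℕ → Measure X) (μ : Measure X) : Prop :=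
  ∃ (νs : ℕ → FiniteMeasure X) (ν : FiniteMeasure X),
    (∀ᶠ m in atTop, (νs m : Measure X) = μs m) ∧ (ν : Measure X) = μ ∧ Tendsto νs atTop (𝓝 ν)

end Toric

/-! The fibre of $\Phi_m$ over a point of $\mathcal O(\sigma)$ stays inside $\mathcal O(\sigma)$.
Indeed $\Phi_m$ raises every monomial to its $m$-th power, so it preserves which monomials vanish at
a point, hence the cone `orbitCone` that labels the orbit. A basis of the free group $N(\sigma)$, of
rank $q=n-\dim\sigma$, turns the orbit into $(\mathbb C^*)^q$ and $\Phi_m$ into the coordinatewise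
$m$-th power. The fibre over $x$ is thus a principal root $x^{1/m}$ times the $m^q$ torsion points
(`multEnd_eq_coordPoint_iff`, `pullbackDirac_multEnd`), and the factor $m^{\dim\sigma-n}$ makes the
measure an average.

As $m\to\infty$ the principal roots tend to $1$, while the $m$-torsion points equidistribute in
$(S^1)^q$. Equidistribution (`eventually_abs_average_sub_integral_le`) needs no Fourier analysis:
Haar measure is invariant under torsion translations, and every point of the compact torus is a
torsion point times an element close to $1$.

The geometric work is to show that the quotient defining $X_\Sigma$ identifies no two points of one
chart. The invariants `ratioGraph` and `orbitCone` are constant under gluing, because faces of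
rational cones are cut out by integral forms; the first recovers a point of a given chart. -/

namespace Toric

/-! ### Rational cones, their faces and the lattice $N(\sigma)$. -/

section ConeLemmas

variable {N : Type*} [AddCommGroup N]

theorem pairing_tmul (u : Module.Dual ℤ N) (r : ℝ) (v : N) :
    pairing u (r ⊗ₜ[ℤ] v) = u v * r := by
  simp [pairing, Module.Dual.baseChange_apply_tmul]

theorem pairing_add_left (u u' : Module.Dual ℤ N) (v : ℝ ⊗[ℤ] N) :
    pairing (u + u') v = pairing u v + pairing u' v := by
  simp [pairing]

/-- A linear form which is nonnegative on the generators of a cone is nonnegative on the cone. -/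
theorem nonneg_of_mem_hull {E : Type*} [AddCommGroup E] [Module ℝ E] {s : Set E}
    {f : Module.Dual ℝ E} (hf : ∀ x ∈ s, 0 ≤ f x) {v : E} (hv : v ∈ PointedCone.hull ℝ s) :
    0 ≤ f v := by
  induction hv using Submodule.span_induction with
  | mem x hx => exact hf x hx
  | zero => simp
  | add x y _ _ hx hy => simpa using add_nonneg hx hy
  | smul c x _ hx =>
    have : f (c • x) = (c : ℝ) * f x := by
      rw [← smul_eq_mul, ← map_smul]; rfl
    rw [this]
    exact mul_nonneg c.2 hx

/-- The vanishing of a nonnegative form on a cone forces the vanishing of another form as soon as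
it does so on generators. -/
theorem eq_zero_of_mem_hull {E : Type*} [AddCommGroup E] [Module ℝ E] {s : Set E}
    {f g : Module.Dual ℝ E} (hf : ∀ x ∈ s, 0 ≤ f x) (hfg : ∀ x ∈ s, f x = 0 → g x = 0)
    {v : E} (hv : v ∈ PointedCone.hull ℝ s) (h0 : f v = 0) : g v = 0 := by
  induction hv using Submodule.span_induction with
  | mem x hx => exact hfg x hx h0
  | zero => simp
  | add x y hx hy ihx ihy =>
    have h1 := nonneg_of_mem_hull hf hx
    have h2 := nonneg_of_mem_hull hf hy
    rw [map_add] at h0 ⊢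
    rw [ihx (by linarith), ihy (by linarith), add_zero]
  | smul c x hx ih =>
    have h1 : ∀ f : Module.Dual ℝ E, f (c • x) = (c : ℝ) * f x := by
      intro f
      rw [← smul_eq_mul, ← map_smul]; rfl
    rw [h1] at h0 ⊢
    rcases mul_eq_zero.1 h0 with h | h
    · rw [h, zero_mul]
    · rw [ih h, mul_zero]

/-- The set of points of a lattice, seen in the ambient real vector space. -/
def realPoints (S : Finset N) : Set (ℝ ⊗[ℤ] N) := (fun v : N => (1 : ℝ) ⊗ₜ[ℤ] v) '' (S : Set N)

theorem mem_dualSemigroup_iff {σ : PointedCone ℝ (ℝ ⊗[ℤ] N)} {S : Finset N}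
    (hS : σ = PointedCone.hull ℝ (realPoints S)) {u : Module.Dual ℤ N} :
    u ∈ dualSemigroup σ ↔ ∀ s ∈ S, 0 ≤ u s := by
  constructor
  · intro h s hs
    have := h ((1 : ℝ) ⊗ₜ[ℤ] s) (hS ▸ PointedCone.subset_hull ⟨s, hs, rfl⟩)
    rw [pairing_tmul, mul_one] at this
    exact_mod_cast this
  · intro h v hv
    rw [hS] at hv
    refine nonneg_of_mem_hull (f := Module.Dual.baseChange ℝ u) ?_ hv
    rintro _ ⟨s, hs, rfl⟩
    change 0 ≤ pairing u _
    rw [pairing_tmul, mul_one]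
    exact_mod_cast h s hs

theorem perp_le_dualSemigroup {σ : PointedCone ℝ (ℝ ⊗[ℤ] N)} {u : Module.Dual ℤ N}
    (hu : u ∈ perp σ) : u ∈ dualSemigroup σ := fun v hv => (hu v hv).ge

/-- A linear form on a lattice which vanishes on the lattice points of a rational cone vanishes on
the cone. -/
theorem mem_perp_of_latticeSpan_le {σ : PointedCone ℝ (ℝ ⊗[ℤ] N)} (hσ : IsRationalPolyhedral σ)
    {u : Module.Dual ℤ N} (hu : latticeSpan σ ≤ LinearMap.ker u) : u ∈ perp σ := by
  obtain ⟨S, hS⟩ := hσ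
  have h : ∀ s ∈ S, u s = 0 := fun s hs =>
    hu (Submodule.subset_span (show (1 : ℝ) ⊗ₜ[ℤ] s ∈ σ from
      hS ▸ PointedCone.subset_hull ⟨s, hs, rfl⟩))
  intro v hv
  refine le_antisymm ?_ ((mem_dualSemigroup_iff hS).2 (fun s hs => (h s hs).ge) v hv)
  have h1 := (mem_dualSemigroup_iff (u := -u) hS).2 (fun s hs => by simp [h s hs]) v hv
  simp only [pairing] at h1 ⊢
  simpa using h1

/-- Localisation: if `τ` is the face of `σ` cut out by `p ∈ σ^∨ ∩ M`, then
`τ^∨ ∩ M = (σ^∨ ∩ M) - ℕ p`. -/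
theorem exists_add_nsmul_mem_dualSemigroup {σ τ : PointedCone ℝ (ℝ ⊗[ℤ] N)}
    (hσ : IsRationalPolyhedral σ) {p : Module.Dual ℤ N} (hp : p ∈ dualSemigroup σ)
    (hτ : ∀ v, v ∈ σ → pairing p v = 0 → v ∈ τ) {w : Module.Dual ℤ N}
    (hw : w ∈ dualSemigroup τ) : ∃ k : ℕ, w + k • p ∈ dualSemigroup σ := by
  obtain ⟨S, hS⟩ := hσ
  -- This $k$ dominates every $|w(s)|$. A generator with $p(s)>0$ has $p(s)\ge 1$, so $k\,p(s)$
  -- outweighs $w(s)$; one with $p(s)=0$ lies in $\tau$, where $w$ is already nonnegative.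
  refine ⟨∑ s ∈ S, (w s).natAbs, (mem_dualSemigroup_iff hS).2 fun s hs => ?_⟩
  have hsσ : (1 : ℝ) ⊗ₜ[ℤ] s ∈ σ := hS ▸ PointedCone.subset_hull ⟨s, hs, rfl⟩
  have h1 : 0 ≤ p s := (mem_dualSemigroup_iff hS).1 hp s hs
  have h2 : (w s).natAbs ≤ ∑ s ∈ S, (w s).natAbs :=
    Finset.single_le_sum (f := fun s => (w s).natAbs) (fun _ _ => Nat.zero_le _) hs
  generalize (∑ s ∈ S, (w s).natAbs) = k at h2 ⊢
  simp only [LinearMap.add_apply, LinearMap.smul_apply, nsmul_eq_mul]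
  rcases h1.eq_or_lt with h | h
  · have h3 := hw _ (hτ _ hsσ (by rw [pairing_tmul, ← h]; simp))
    rw [pairing_tmul, mul_one] at h3
    rw [← h, mul_zero, add_zero]
    exact_mod_cast h3
  · have h4 : (k : ℤ) ≤ k * p s := le_mul_of_one_le_right (by positivity) (by omega)
    omega

/-- A real form on a finitely generated abelian group can be replaced by an integral one with the
same zeros and such that finitely many positive values remain positive. -/
theorem exists_integral_form [Module.Finite ℤ N] (f : N →ₗ[ℤ] ℝ) (S : Finset N) :
    ∃ p : Module.Dual ℤ N, (∀ s, f s = 0 → p s = 0) ∧ ∀ s ∈ S, 0 < f s → 0 < p s := by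
  classical
  let A := LinearMap.range f
  have : Module.Finite ℤ A := inferInstance
  have : Module.IsTorsionFree ℤ A := inferInstance
  have : Module.Free ℤ A := Module.free_of_finite_type_torsion_free'
  let B := Module.Free.chooseBasis ℤ A
  let ι := Module.Free.ChooseBasisIndex ℤ A
  -- Here $f=\sum_i c_iB_i$ with integral forms $c_i$ and real numbers $B_i$ independent over
  -- $\mathbb Z$. A zero of $f$ kills every $c_i$, so the $B_i$ may be perturbed to rationals
  -- without losing zeros; finitely many positivity conditions survive a small perturbation.
  let c : ι → N →ₗ[ℤ] ℤ := fun i => B.coord i ∘ₗ f.rangeRestrict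
  have hc : ∀ s, f s = ∑ i, (c i s : ℝ) * (B i : ℝ) := by
    intro s
    have := congrArg A.subtype (B.sum_repr (f.rangeRestrict s))
    rw [map_sum] at this
    simpa [c] using this.symm
  have hc0 : ∀ s, f s = 0 → ∀ i, c i s = 0 := by
    intro s hs i
    have : f.rangeRestrict s = 0 := Subtype.ext hs
    simp [c, this]
  let U : Set (ι → ℝ) := {r | ∀ s ∈ S, 0 < f s → 0 < ∑ i, (c i s : ℝ) * r i}
  have hU : IsOpen U := by
    have : U = ⋂ s ∈ S, ⋂ _ : 0 < f s, {r | 0 < ∑ i, (c i s : ℝ) * r i} := by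
      ext r; simp [U]
    rw [this]
    refine isOpen_biInter_finset fun s _ => isOpen_iInter_of_finite fun _ => ?_
    exact isOpen_lt continuous_const (by fun_prop)
  have hB : (fun i => (B i : ℝ)) ∈ U := fun s _ h => by rwa [← hc]
  have hd : DenseRange (Pi.map fun (_ : ι) (q : ℚ) => (q : ℝ)) :=
    DenseRange.piMap fun _ => Rat.denseRange_cast
  obtain ⟨q, hq⟩ := hd.exists_mem_open hU ⟨_, hB⟩
  obtain ⟨D, hD⟩ := IsLocalization.exist_integer_multiples (nonZeroDivisors ℤ)
    (Finset.univ : Finset ι) q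
  choose n hn using fun i => hD i (Finset.mem_univ i)
  have hn' : ∀ i, (n i : ℝ) = (D : ℤ) * (q i : ℝ) := by
    intro i
    have := hn i
    simp only [algebraMap_int_eq, eq_intCast, Algebra.smul_def] at this
    exact_mod_cast this
  have hD0 : ((D : ℤ) : ℝ) ≠ 0 := by
    exact_mod_cast nonZeroDivisors.ne_zero D.2
  -- The common denominator $D$ may be negative; the coefficients $D n_i=D^2q_i$ avoid a sign
  -- problem.
  refine ⟨∑ i, ((D : ℤ) * n i) • c i, fun s hs => by simp [hc0 s hs], fun s hs h => ?_⟩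
  have h1 := hq s hs h
  have h2 : (((∑ i, ((D : ℤ) * n i) • c i : Module.Dual ℤ N) s : ℤ) : ℝ)
      = ((D : ℤ) : ℝ) ^ 2 * ∑ i, (c i s : ℝ) * q i := by
    simp only [LinearMap.sum_apply, LinearMap.smul_apply, smul_eq_mul, Int.cast_sum,
      Int.cast_mul, Finset.mul_sum, hn']
    exact Finset.sum_congr rfl fun i _ => by ring
  have h3 : (0 : ℝ) < ((∑ i, ((D : ℤ) * n i) • c i : Module.Dual ℤ N) s : ℤ) := by
    rw [h2]
    exact mul_pos (by positivity) h1
  exact_mod_cast h3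

/-- A face of a rational cone is cut out by an integral form. -/
theorem IsFace.exists_integral [Module.Finite ℤ N] {σ τ : PointedCone ℝ (ℝ ⊗[ℤ] N)}
    (hσ : IsRationalPolyhedral σ) (h : IsFace τ σ) :
    ∃ p ∈ dualSemigroup σ, ∀ v, v ∈ τ ↔ v ∈ σ ∧ pairing p v = 0 := by
  obtain ⟨S, hS⟩ := hσ
  obtain ⟨u, hu, huτ⟩ := h
  let f : N →ₗ[ℤ] ℝ := (u.restrictScalars ℤ) ∘ₗ TensorProduct.mk ℤ ℝ N 1
  have hf : ∀ s, f s = u ((1 : ℝ) ⊗ₜ[ℤ] s) := fun s => rfl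
  have hf0 : ∀ s ∈ S, 0 ≤ f s := fun s hs =>
    hu _ (hS ▸ PointedCone.subset_hull ⟨s, hs, rfl⟩)
  obtain ⟨p, hp0, hp⟩ := exists_integral_form f S
  have hpS : ∀ s ∈ S, 0 ≤ p s := fun s hs => by
    rcases (hf0 s hs).eq_or_lt with h | h
    · exact (hp0 s h.symm).ge
    · exact (hp s hs h).le
  refine ⟨p, (mem_dualSemigroup_iff hS).2 hpS, fun v => (huτ v).trans
    (and_congr_right fun hv => ?_)⟩
  rw [hS] at hv
  have hp1 : ∀ s : N, Module.Dual.baseChange ℝ p ((1 : ℝ) ⊗ₜ[ℤ] s) = p s := fun s => by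
    simp
  constructor
  · refine eq_zero_of_mem_hull (g := Module.Dual.baseChange ℝ p) ?_ ?_ hv
    · rintro _ ⟨s, hs, rfl⟩
      exact hf0 s hs
    · rintro _ ⟨s, hs, rfl⟩ h
      simp only [hp1]
      exact_mod_cast hp0 s h
  · refine eq_zero_of_mem_hull (f := Module.Dual.baseChange ℝ p) ?_ ?_ hv
    · rintro _ ⟨s, hs, rfl⟩
      simp only [hp1]
      exact_mod_cast hpS s hs
    · rintro _ ⟨s, hs, rfl⟩ h
      simp only [hp1] at h
      by_contra h'
      have := hp s hs (lt_of_le_of_ne (hf0 s hs) (Ne.symm h'))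
      have h'' : p s = 0 := by exact_mod_cast h
      omega

/-- Every point of the linear span of a rational cone moves into the cone when a suitable lattice
point of the cone is added. -/
theorem exists_add_tmul_mem {σ : PointedCone ℝ (ℝ ⊗[ℤ] N)} (hσ : IsRationalPolyhedral σ)
    {x : ℝ ⊗[ℤ] N} (hx : x ∈ Submodule.span ℝ (σ : Set (ℝ ⊗[ℤ] N))) :
    ∃ w : N, (1 : ℝ) ⊗ₜ[ℤ] w ∈ σ ∧ x + (1 : ℝ) ⊗ₜ[ℤ] w ∈ σ := by
  obtain ⟨S, hS⟩ := hσ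
  have hsmul : ∀ (r : ℝ), 0 ≤ r → ∀ y ∈ σ, r • y ∈ σ := fun r hr y hy =>
    PointedCone.smul_mem σ hr hy
  have hx' : x ∈ Submodule.span ℝ (realPoints S) := by
    refine Submodule.span_le.2 ?_ hx
    rw [hS]
    exact fun v hv => PointedCone.hull_le_span (R := ℝ) (realPoints S) hv
  -- The claim is strengthened to be symmetric in $\pm x$, so that the induction passes through
  -- negative scalars.
  suffices h : ∃ w : N, (1 : ℝ) ⊗ₜ[ℤ] w ∈ σ ∧ x + (1 : ℝ) ⊗ₜ[ℤ] w ∈ σ ∧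
      -x + (1 : ℝ) ⊗ₜ[ℤ] w ∈ σ from let ⟨w, h1, h2, _⟩ := h; ⟨w, h1, h2⟩
  clear hx
  induction hx' using Submodule.span_induction with
  | mem x hx =>
    obtain ⟨s, hs, rfl⟩ := hx
    have : (1 : ℝ) ⊗ₜ[ℤ] s ∈ σ := hS ▸ PointedCone.subset_hull ⟨s, hs, rfl⟩
    exact ⟨s, this, add_mem this this, by simp⟩
  | zero => exact ⟨0, by simp, by simp, by simp⟩
  | add x y _ _ hx hy =>
    obtain ⟨w, h1, h2, h3⟩ := hx
    obtain ⟨w', h1', h2', h3'⟩ := hy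
    refine ⟨w + w', ?_, ?_, ?_⟩
    · rw [TensorProduct.tmul_add]; exact add_mem h1 h1'
    · rw [TensorProduct.tmul_add, add_add_add_comm]; exact add_mem h2 h2'
    · rw [TensorProduct.tmul_add, neg_add, add_add_add_comm]; exact add_mem h3 h3'
  | smul r x _ hx =>
    obtain ⟨w, h1, h2, h3⟩ := hx
    obtain ⟨k, hk⟩ := exists_nat_ge |r|
    have hk' : (1 : ℝ) ⊗ₜ[ℤ] (k • w) = (k : ℝ) • ((1 : ℝ) ⊗ₜ[ℤ] w) := by
      rw [TensorProduct.tmul_smul, Nat.cast_smul_eq_nsmul]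
    have key : ∀ r : ℝ, |r| ≤ k → r • x + (k : ℝ) • ((1 : ℝ) ⊗ₜ[ℤ] w) ∈ σ := by
      intro r hr
      rcases le_total 0 r with h0 | h0
      · have h4 := add_mem (hsmul r h0 _ h2)
          (hsmul (k - r) (by rw [abs_of_nonneg h0] at hr; linarith) _ h1)
        convert h4 using 1
        module
      · have h4 := add_mem (hsmul (-r) (by linarith) _ h3)
          (hsmul (k + r) (by rw [abs_of_nonpos h0] at hr; linarith) _ h1)
        convert h4 using 1
        module
    refine ⟨k • w, ?_, ?_, ?_⟩
    · rw [hk']; exact hsmul _ (by positivity) _ h1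
    · rw [hk']; exact key r hk
    · rw [hk', ← neg_smul]; exact key (-r) (by rwa [abs_neg])

/-- The sublattice `N_σ` consists of the lattice points of the linear span of `σ`. -/
theorem mem_latticeSpan_iff {σ : PointedCone ℝ (ℝ ⊗[ℤ] N)} (hσ : IsRationalPolyhedral σ)
    {v : N} : v ∈ latticeSpan σ ↔ (1 : ℝ) ⊗ₜ[ℤ] v ∈ Submodule.span ℝ (σ : Set (ℝ ⊗[ℤ] N)) := by
  constructor
  · intro h
    induction h using Submodule.span_induction with
    | mem x hx => exact Submodule.subset_span hx
    | zero => simp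
    | add x y _ _ hx hy => rw [TensorProduct.tmul_add]; exact add_mem hx hy
    | smul k x _ hx =>
      rw [TensorProduct.tmul_smul]; exact zsmul_mem hx k
  · intro h
    obtain ⟨w, h1, h2⟩ := exists_add_tmul_mem hσ h
    rw [← TensorProduct.tmul_add] at h2
    have h3 : v + w ∈ latticeSpan σ := Submodule.subset_span h2
    have h4 : w ∈ latticeSpan σ := Submodule.subset_span h1
    simpa using sub_mem h3 h4

/-- By `mem_latticeSpan_iff`, $N_\sigma$ is the trace on $N$ of a real subspace, hence saturated;
the quotient is torsion-free and finitely generated. -/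
theorem quotLattice_free [Module.Finite ℤ N] {σ : PointedCone ℝ (ℝ ⊗[ℤ] N)}
    (hσ : IsRationalPolyhedral σ) : Module.Free ℤ (QuotLattice σ) := by
  have : Module.IsTorsionFree ℤ (QuotLattice σ) := by
    rw [Module.isTorsionFree_iff_smul_eq_zero]
    intro k x
    obtain ⟨v, rfl⟩ := (latticeSpan σ).mkQ_surjective x
    intro h
    by_cases hk : k = 0
    · exact Or.inl hk
    right
    rw [← map_smul, Submodule.mkQ_apply, Submodule.Quotient.mk_eq_zero,
      mem_latticeSpan_iff hσ, TensorProduct.tmul_smul] at h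
    rw [Submodule.mkQ_apply, Submodule.Quotient.mk_eq_zero, mem_latticeSpan_iff hσ]
    have h1 := Submodule.smul_mem _ ((k : ℝ)⁻¹) h
    rwa [← Int.cast_smul_eq_zsmul ℝ, smul_smul, inv_mul_cancel₀ (by exact_mod_cast hk),
      one_smul] at h1
  exact Module.free_of_finite_type_torsion_free'

/-- Rank–nullity for $N_{\mathbb R}\to N(\sigma)_{\mathbb R}$, whose kernel is the span of $\sigma$
by right exactness of the tensor product. It turns the exponent $\dim\sigma-n$ into minus the rank
of $N(\sigma)$. -/
theorem finrank_quotLattice_add_coneDim [Module.Free ℤ N] [Module.Finite ℤ N]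
    {σ : PointedCone ℝ (ℝ ⊗[ℤ] N)} (hσ : IsRationalPolyhedral σ) :
    Module.finrank ℤ (QuotLattice σ) + coneDim σ = Module.finrank ℤ N := by
  have := quotLattice_free hσ
  let g : ℝ ⊗[ℤ] N →ₗ[ℝ] ℝ ⊗[ℤ] QuotLattice σ := (latticeSpan σ).mkQ.baseChange ℝ
  have hg : Function.Surjective g :=
    LinearMap.lTensor_surjective ℝ (latticeSpan σ).mkQ_surjective
  have hex : Function.Exact ((latticeSpan σ).subtype.lTensor ℝ) ((latticeSpan σ).mkQ.lTensor ℝ) :=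
    lTensor_exact ℝ (LinearMap.exact_subtype_mkQ _) (latticeSpan σ).mkQ_surjective
  have hker : LinearMap.ker g = Submodule.span ℝ (σ : Set (ℝ ⊗[ℤ] N)) := by
    apply le_antisymm
    · intro x hx
      obtain ⟨y, rfl⟩ := (hex x).1 hx
      induction y using TensorProduct.induction_on with
      | zero => simp
      | tmul r v =>
        have h1 := Submodule.smul_mem _ r ((mem_latticeSpan_iff hσ).1 v.2)
        simpa [TensorProduct.smul_tmul'] using h1
      | add y z hy hz =>
        rw [map_add]
        refine add_mem (hy ?_) (hz ?_) <;> exact (hex _).2 ⟨_, rfl⟩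
    · obtain ⟨S, hS⟩ := hσ
      have hs : ∀ s ∈ S, s ∈ latticeSpan σ := fun s hs =>
        Submodule.subset_span (show (1 : ℝ) ⊗ₜ[ℤ] s ∈ σ from
          hS ▸ PointedCone.subset_hull ⟨s, hs, rfl⟩)
      have h2 : realPoints S ⊆ LinearMap.ker g := by
        rintro _ ⟨s, hs', rfl⟩
        have h3 : (latticeSpan σ).mkQ s = 0 := by simpa using hs s hs'
        simp only [SetLike.mem_coe, LinearMap.mem_ker, g, LinearMap.baseChange_tmul, h3,
          TensorProduct.tmul_zero]
      rw [Submodule.span_le]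
      have h4 := (PointedCone.hull_le_span (R := ℝ) (realPoints S))
      intro v hv
      refine Submodule.span_le.2 h2 (h4 ?_)
      rw [hS] at hv
      exact hv
  have h := LinearMap.finrank_range_add_finrank_ker g
  rw [LinearMap.range_eq_top.2 hg, finrank_top, hker, Module.finrank_baseChange,
    Module.finrank_baseChange] at h
  exact h

end ConeLemmas

/-! ### Coordinates on tori from a basis of the lattice. -/

section Coordinates

variable {L : Type*} [AddCommGroup L] {ι : Type*} [Fintype ι]

/-- The isomorphism `G^ι → G ⊗ L` given by a basis of `L`. -/
noncomputable def torusOfCoords {G : Type*} [CommGroup G] (b : Module.Basis ι ℤ L) (x : ι → G) :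
    Additive G ⊗[ℤ] L :=
  ∑ i, Additive.ofMul (x i) ⊗ₜ[ℤ] b i

theorem character_torusOfCoords {G : Type*} [CommGroup G] (b : Module.Basis ι ℤ L) (x : ι → G)
    (u : Module.Dual ℤ L) : character G u (torusOfCoords b x) = ∏ i, x i ^ u (b i) := by
  simp [character, torusOfCoords]

theorem character_coord_torusOfCoords {G : Type*} [CommGroup G] (b : Module.Basis ι ℤ L)
    (x : ι → G) (i : ι) : character G (b.coord i) (torusOfCoords b x) = x i := by
  classical
  rw [character_torusOfCoords]
  rw [Finset.prod_eq_single i (fun j _ hj => by simp [Finsupp.single_eq_of_ne' hj])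
    (by simp)]
  simp

theorem torusOfCoords_mul {G : Type*} [CommGroup G] (b : Module.Basis ι ℤ L) (x y : ι → G) :
    torusOfCoords b (x * y) = torusOfCoords b x + torusOfCoords b y := by
  simp [torusOfCoords, TensorProduct.add_tmul, Finset.sum_add_distrib]

theorem torusOfCoords_surjective {G : Type*} [CommGroup G] (b : Module.Basis ι ℤ L) :
    Function.Surjective (torusOfCoords (G := G) b) := by
  intro s
  induction s using TensorProduct.induction_on with
  | zero => exact ⟨1, by simp [torusOfCoords]⟩
  | tmul g v =>
    refine ⟨fun i => g.toMul ^ (b.repr v i), ?_⟩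
    conv_rhs => rw [← b.sum_repr v, TensorProduct.tmul_sum]
    exact Finset.sum_congr rfl fun i _ => TensorProduct.smul_tmul (b.repr v i) g (b i)
  | add x y hx hy =>
    obtain ⟨z, rfl⟩ := hx
    obtain ⟨w, rfl⟩ := hy
    exact ⟨z * w, torusOfCoords_mul b z w⟩

theorem compactToComplex_torusOfCoords (b : Module.Basis ι ℤ L) (c : ι → Circle) :
    compactToComplex (L := L) (torusOfCoords b c)
      = torusOfCoords b fun i => Circle.toUnits (c i) := by
  simp only [compactToComplex, torusOfCoords, map_sum, LinearMap.rTensor_tmul]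
  rfl

/-- A homomorphism from the dual lattice is evaluation of characters at a point of the torus. -/
theorem exists_torusOfCoords_of_hom {G : Type*} [CommGroup G] (b : Module.Basis ι ℤ L)
    (g : Module.Dual ℤ L → G) (hg : ∀ u u', g (u + u') = g u * g u') :
    ∃ x : ι → G, ∀ u, g u = character G u (torusOfCoords b x) := by
  classical
  let h : Module.Dual ℤ L →+ Additive G :=
    AddMonoidHom.mk' (fun u => Additive.ofMul (g u)) fun u u' => by simp [hg]
  let h' : Module.Dual ℤ L →+ Additive G :=
    AddMonoidHom.mk' (fun u => Additive.ofMul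
      (character G u (torusOfCoords b fun i => g (b.coord i)))) fun u u' => by
        simp [character_add_left]
  refine ⟨fun i => g (b.coord i), fun u => ?_⟩
  have : h.toIntLinearMap = h'.toIntLinearMap := by
    refine b.dualBasis.ext fun i => ?_
    rw [b.coe_dualBasis]
    exact congrArg Additive.ofMul 
      (character_coord_torusOfCoords b (fun i => g (b.coord i)) i).symm
  exact congrArg Additive.toMul (LinearMap.congr_fun this u)

end Coordinates

/-! ### Invariants of points that do not depend on the chart. -/

section Points

variable {N : Type*} [AddCommGroup N]

theorem AffineChart.eval_nsmul {σ : PointedCone ℝ (ℝ ⊗[ℤ] N)} (γ : AffineChart σ) (k : ℕ)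
    (u : dualSemigroup σ) : γ.eval (k • u) = γ.eval u ^ k := by
  induction k with
  | zero => simp [γ.eval_zero]
  | succ k ih => rw [succ_nsmul, γ.eval_add, ih, pow_succ]

theorem AffineChart.eval_ne_zero_of_mem_perp {σ : PointedCone ℝ (ℝ ⊗[ℤ] N)} (γ : AffineChart σ)
    {u : dualSemigroup σ} (hu : (u : Module.Dual ℤ N) ∈ perp σ) : γ.eval u ≠ 0 := by
  have h : u + ⟨-u, perp_le_dualSemigroup (neg_mem hu)⟩ = 0 := Subtype.ext (by simp)
  intro h0
  have h1 := γ.eval_add u ⟨-u, perp_le_dualSemigroup (neg_mem hu)⟩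
  rw [h, γ.eval_zero, h0, zero_mul] at h1
  exact one_ne_zero h1

/-- The graph of the character which a point induces on the group generated by the monomials not
vanishing at it. -/
def AffineChart.ratioGraph {σ : PointedCone ℝ (ℝ ⊗[ℤ] N)} (γ : AffineChart σ) :
    Set (Module.Dual ℤ N × ℂ) :=
  {y | ∃ a b : dualSemigroup σ, γ.eval a ≠ 0 ∧ γ.eval b ≠ 0 ∧ y.1 + b = a ∧
    y.2 * γ.eval b = γ.eval a}

/-- The face of `σ` on which all monomials not vanishing at a point are zero. -/
def AffineChart.orbitCone {σ : PointedCone ℝ (ℝ ⊗[ℤ] N)} (γ : AffineChart σ) :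
    Set (ℝ ⊗[ℤ] N) :=
  {v | v ∈ σ ∧ ∀ u : dualSemigroup σ, γ.eval u ≠ 0 → pairing (u : Module.Dual ℤ N) v = 0}

/-- If $u+b=a$ with $b$ nonvanishing, multiplicativity forces the ratio to be the value at $u$;
conversely $b=0$ serves as denominator. So the graph determines all nonzero values, and thereby the
point. -/
theorem AffineChart.mem_ratioGraph_iff {σ : PointedCone ℝ (ℝ ⊗[ℤ] N)} (γ : AffineChart σ)
    (u : dualSemigroup σ) (c : ℂ) (hc : c ≠ 0) :
    ((u : Module.Dual ℤ N), c) ∈ γ.ratioGraph ↔ γ.eval u = c := by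
  constructor
  · rintro ⟨a, b, -, hb, h1, h2⟩
    have h3 : u + b = a := Subtype.ext h1
    rw [← h3, γ.eval_add] at h2
    exact (mul_right_cancel₀ hb h2).symm
  · intro h
    refine ⟨u, 0, h ▸ hc, by simp [γ.eval_zero], by simp, by simp [γ.eval_zero, h]⟩

theorem AffineChart.eq_of_ratioGraph_eq {σ : PointedCone ℝ (ℝ ⊗[ℤ] N)} {γ γ' : AffineChart σ}
    (h : γ.ratioGraph = γ'.ratioGraph) : γ = γ' := by
  ext u
  by_cases h0 : γ.eval u = 0
  · by_contra h1
    have h2 : γ'.eval u ≠ 0 := fun h' => h1 (h0.trans h'.symm)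
    have h3 := (γ'.mem_ratioGraph_iff u _ h2).2 rfl
    rw [← h, γ.mem_ratioGraph_iff u _ h2] at h3
    exact h1 h3
  · have h3 := (γ.mem_ratioGraph_iff u _ h0).2 rfl
    rw [h, γ'.mem_ratioGraph_iff u _ h0] at h3
    exact h3.symm

section Incl

variable {σ τ : PointedCone ℝ (ℝ ⊗[ℤ] N)} {p : Module.Dual ℤ N}

/-- Comparison of the monomials on `U_σ` and on the chart `U_τ` of a face. -/
theorem exists_eval_incl (hσ : IsRationalPolyhedral σ)
    (hp : p ∈ dualSemigroup σ) (hτ : ∀ v, v ∈ τ ↔ v ∈ σ ∧ pairing p v = 0) (h : τ ≤ σ)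
    (δ : AffineChart τ) (u : dualSemigroup τ) :
    ∃ a b : dualSemigroup σ, (u : Module.Dual ℤ N) + b = a ∧ (δ.incl h).eval b ≠ 0 ∧
      δ.eval u * (δ.incl h).eval b = (δ.incl h).eval a := by
  obtain ⟨k, hk⟩ := exists_add_nsmul_mem_dualSemigroup hσ hp (fun v h1 h2 => (hτ v).2 ⟨h1, h2⟩) u.2
  refine ⟨⟨_, hk⟩, ⟨k • p, nsmul_mem hp k⟩, rfl, ?_, ?_⟩
  · refine δ.eval_ne_zero_of_mem_perp (nsmul_mem ?_ k)
    exact fun v hv => ((hτ v).1 hv).2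
  · exact (δ.eval_add _ _).symm

/-- Passing to a face only inverts the monomial $p$. Fractions of monomials on $U_\tau$ become
fractions on $U_\sigma$ after clearing denominators that do not vanish at the point. -/
theorem ratioGraph_incl (hσ : IsRationalPolyhedral σ)
    (hp : p ∈ dualSemigroup σ) (hτ : ∀ v, v ∈ τ ↔ v ∈ σ ∧ pairing p v = 0) (h : τ ≤ σ)
    (δ : AffineChart τ) : (δ.incl h).ratioGraph = δ.ratioGraph := by
  ext ⟨w, c⟩
  constructor
  · rintro ⟨a, b, ha, hb, h1, h2⟩
    exact ⟨_, _, ha, hb, h1, h2⟩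
  · rintro ⟨a, b, ha, hb, h1, h2⟩
    obtain ⟨a1, b1, h3, h4, h5⟩ := exists_eval_incl hσ hp hτ h δ a
    obtain ⟨a2, b2, h6, h7, h8⟩ := exists_eval_incl hσ hp hτ h δ b
    refine ⟨a1 + b2, a2 + b1, ?_, ?_, ?_, ?_⟩
    · rw [AffineChart.eval_add, ← h5]
      exact mul_ne_zero (mul_ne_zero ha h4) h7
    · rw [AffineChart.eval_add, ← h8]
      exact mul_ne_zero (mul_ne_zero hb h7) h4
    · simp only at h1
      simp only [AddSubmonoid.coe_add, ← h3, ← h6, ← h1]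
      abel
    · simp only at h2
      rw [AffineChart.eval_add, AffineChart.eval_add, ← h5, ← h8, ← h2]
      ring

/-- The form $p$ is zero on $\tau$, so its monomial is invertible on $U_\tau$; requiring it to
vanish at $v\in\sigma$ already puts $v$ in $\tau$. -/
theorem orbitCone_incl (hσ : IsRationalPolyhedral σ)
    (hp : p ∈ dualSemigroup σ) (hτ : ∀ v, v ∈ τ ↔ v ∈ σ ∧ pairing p v = 0) (h : τ ≤ σ)
    (δ : AffineChart τ) : (δ.incl h).orbitCone = δ.orbitCone := by
  ext v
  constructor
  · rintro ⟨hv, hv'⟩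
    have h0 : v ∈ τ := (hτ v).2 ⟨hv, hv' ⟨p, hp⟩
      (δ.eval_ne_zero_of_mem_perp fun v hv => ((hτ v).1 hv).2)⟩
    refine ⟨h0, fun u hu => ?_⟩
    obtain ⟨a, b, h1, h2, h3⟩ := exists_eval_incl hσ hp hτ h δ u
    have h4 := hv' b h2
    have h5 := hv' a (h3 ▸ mul_ne_zero hu h2)
    rw [← h1, pairing_add_left, h4, add_zero] at h5
    exact h5
  · rintro ⟨hv, hv'⟩
    exact ⟨h hv, fun u hu => hv' (AddSubmonoid.inclusion (dualSemigroup_anti h) u) hu⟩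

end Incl

/-! ### Points of an orbit, and how to recognise them by their orbit cone. -/

section OrbitPoints

variable {σ : PointedCone ℝ (ℝ ⊗[ℤ] N)}

theorem orbitPoint_eval (t : ComplexTorus (QuotLattice σ)) {u : dualSemigroup σ}
    (h : (u : Module.Dual ℤ N) ∈ perp σ) :
    (orbitPoint σ t).eval u = character ℂˣ (descend (u : Module.Dual ℤ N) h) t := by
  simp [orbitPoint, h]

theorem orbitPoint_eval_of_notMem (t : ComplexTorus (QuotLattice σ)) {u : dualSemigroup σ}
    (h : (u : Module.Dual ℤ N) ∉ perp σ) : (orbitPoint σ t).eval u = 0 := by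
  simp [orbitPoint, h]

theorem orbitCone_orbitPoint (t : ComplexTorus (QuotLattice σ)) :
    (orbitPoint σ t).orbitCone = σ := by
  ext v
  refine ⟨fun h => h.1, fun h => ⟨h, fun u hu => ?_⟩⟩
  by_contra h'
  exact hu (orbitPoint_eval_of_notMem t fun hp => h' (hp v h))

theorem mkQ_comp_mem_perp (hσ : IsRationalPolyhedral σ) (u : Module.Dual ℤ (QuotLattice σ)) :
    u ∘ₗ (latticeSpan σ).mkQ ∈ perp σ := by
  refine mem_perp_of_latticeSpan_le hσ fun v hv => ?_
  simp [(Submodule.Quotient.mk_eq_zero _).2 hv]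

theorem descend_mkQ_comp (u : Module.Dual ℤ (QuotLattice σ))
    (h : u ∘ₗ (latticeSpan σ).mkQ ∈ perp σ) : descend _ h = u := by
  ext v
  simp [descend]

theorem descend_comp_mkQ {u : Module.Dual ℤ N} (h : u ∈ perp σ) :
    descend u h ∘ₗ (latticeSpan σ).mkQ = u :=
  Submodule.liftQ_mkQ _ _ _

variable {ι : Type*} [Fintype ι]

theorem orbitPoint_eval_mk (t : ComplexTorus (QuotLattice σ)) {w : Module.Dual ℤ N}
    (h : w ∈ perp σ) :
    (orbitPoint σ t).eval ⟨w, perp_le_dualSemigroup h⟩ = character ℂˣ (descend w h) t :=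
  orbitPoint_eval t (u := ⟨w, perp_le_dualSemigroup h⟩) h

theorem orbitPoint_eval_comp_mkQ (hσ : IsRationalPolyhedral σ) (t : ComplexTorus (QuotLattice σ))
    (u : Module.Dual ℤ (QuotLattice σ)) :
    (orbitPoint σ t).eval ⟨u ∘ₗ (latticeSpan σ).mkQ,
      perp_le_dualSemigroup (mkQ_comp_mem_perp hσ u)⟩ = (character ℂˣ u t : ℂ) := by
  rw [orbitPoint_eval_mk t (mkQ_comp_mem_perp hσ u), descend_mkQ_comp]

/-- Each coordinate form of $N(\sigma)$ pulls back to an element of $\sigma^\perp\cap M$, so every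
coordinate is the value of a monomial. -/
theorem orbitPoint_torusOfCoords_injective (hσ : IsRationalPolyhedral σ)
    (b : Module.Basis ι ℤ (QuotLattice σ)) :
    Function.Injective fun x : ι → ℂˣ => orbitPoint σ (torusOfCoords b x) := by
  intro x y h
  funext i
  have h1 : orbitPoint σ (torusOfCoords b x) = orbitPoint σ (torusOfCoords b y) := h
  have h2 := orbitPoint_eval_comp_mkQ hσ (torusOfCoords b x) (b.coord i)
  rw [h1, orbitPoint_eval_comp_mkQ hσ] at h2
  have h3 := Units.ext h2
  rw [character_coord_torusOfCoords, character_coord_torusOfCoords] at h3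
  exact h3.symm

theorem continuous_orbitPoint_torusOfCoords (b : Module.Basis ι ℤ (QuotLattice σ)) :
    Continuous fun x : ι → ℂˣ => orbitPoint σ (torusOfCoords b x) := by
  refine continuous_induced_rng.2 (continuous_pi fun u => ?_)
  by_cases h : (u : Module.Dual ℤ N) ∈ perp σ
  · simp only [Function.comp_def, orbitPoint_eval _ h, character_torusOfCoords]
    exact Units.continuous_val.comp
      (continuous_finsetProd _ fun i _ => (continuous_apply i).zpow _)
  · simp only [Function.comp_def, orbitPoint_eval_of_notMem _ h]
    exact continuous_const

/-- The map induced by multiplication by `m` raises the values of all monomials to the `m`-th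
power. -/
theorem mapEnd_nsmul_eval (m : ℕ) (γ : AffineChart σ)
    (h : ∀ v ∈ σ, (m • (LinearMap.id : N →ₗ[ℤ] N)).baseChange ℝ v ∈ σ) (u : dualSemigroup σ) :
    (γ.mapEnd (m • LinearMap.id) h).eval u = γ.eval u ^ m := by
  rw [← γ.eval_nsmul]
  refine congrArg γ.eval (Subtype.ext ?_)
  ext v
  simp

theorem mapEnd_orbitPoint (m : ℕ) (hm : m ≠ 0) (b : Module.Basis ι ℤ (QuotLattice σ)) (x : ι → ℂˣ)
    (h : ∀ v ∈ σ, (m • (LinearMap.id : N →ₗ[ℤ] N)).baseChange ℝ v ∈ σ) :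
    (orbitPoint σ (torusOfCoords b x)).mapEnd (m • LinearMap.id) h
      = orbitPoint σ (torusOfCoords b (x ^ m)) := by
  ext u
  rw [mapEnd_nsmul_eval]
  by_cases hu : (u : Module.Dual ℤ N) ∈ perp σ
  · rw [orbitPoint_eval _ hu, orbitPoint_eval _ hu, character_torusOfCoords,
      character_torusOfCoords, ← Units.val_pow_eq_pow_val, ← Finset.prod_pow]
    congr 1
    refine Finset.prod_congr rfl fun i _ => ?_
    rw [Pi.pow_apply, ← zpow_natCast, ← zpow_natCast, zpow_comm]
  · rw [orbitPoint_eval_of_notMem _ hu, orbitPoint_eval_of_notMem _ hu, zero_pow hm]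

theorem orbitCone_mapEnd (m : ℕ) (hm : m ≠ 0) (γ : AffineChart σ)
    (h : ∀ v ∈ σ, (m • (LinearMap.id : N →ₗ[ℤ] N)).baseChange ℝ v ∈ σ) :
    (γ.mapEnd (m • LinearMap.id) h).orbitCone = γ.orbitCone := by
  ext v
  simp only [AffineChart.orbitCone, mapEnd_nsmul_eval, ne_eq, pow_eq_zero_iff hm]

/-- Some monomial not vanishing at a point cuts out its orbit cone. -/
theorem exists_eval_ne_zero_of_orbitCone {τ : PointedCone ℝ (ℝ ⊗[ℤ] N)}
    (hτ : IsRationalPolyhedral τ) (γ : AffineChart τ) (hγ : γ.orbitCone = σ) :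
    ∃ p : dualSemigroup τ, γ.eval p ≠ 0 ∧
      ∀ v, v ∈ σ ↔ v ∈ τ ∧ pairing (p : Module.Dual ℤ N) v = 0 := by
  classical
  obtain ⟨S, hS⟩ := hτ
  have hSτ : ∀ s ∈ S, (1 : ℝ) ⊗ₜ[ℤ] s ∈ τ := fun s hs =>
    hS ▸ PointedCone.subset_hull ⟨s, hs, rfl⟩
  have hmem : ∀ v, v ∈ σ ↔ v ∈ τ ∧ ∀ u : dualSemigroup τ, γ.eval u ≠ 0 →
      pairing (u : Module.Dual ℤ N) v = 0 := fun v => by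
    rw [← SetLike.mem_coe, ← hγ]; rfl
  have h1 : ∀ s : N, ∃ u : dualSemigroup τ, γ.eval u ≠ 0 ∧
      (s ∈ S → (1 : ℝ) ⊗ₜ[ℤ] s ∉ σ → (u : Module.Dual ℤ N) s ≠ 0) := by
    intro s
    by_cases hs : s ∈ S ∧ (1 : ℝ) ⊗ₜ[ℤ] s ∉ σ
    · have h2 := hs.2
      rw [hmem] at h2
      push Not at h2
      obtain ⟨u, hu, hu'⟩ := h2 (hSτ s hs.1)
      rw [pairing_tmul, mul_one] at hu'
      exact ⟨u, hu, fun _ _ => by exact_mod_cast hu'⟩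
    · exact ⟨0, by simp [γ.eval_zero], fun h h' => absurd ⟨h, h'⟩ hs⟩
  choose u hu hu' using h1
  -- The sum of the chosen monomials is nonvanishing, and it is strictly positive on each generator
  -- outside $\sigma$ since the terms cannot cancel.
  have hp : ∀ T : Finset N, γ.eval (∑ s ∈ T, u s) ≠ 0 := by
    intro T
    induction T using Finset.induction_on with
    | empty => simp [γ.eval_zero]
    | insert s T hs ih => rw [Finset.sum_insert hs, γ.eval_add]; exact mul_ne_zero (hu s) ih
  refine ⟨∑ s ∈ S, u s, hp S, fun v => ⟨fun h => ⟨((hmem v).1 h).1, ((hmem v).1 h).2 _ (hp S)⟩,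
    fun ⟨hv, hv0⟩ => (hmem v).2 ⟨hv, fun w hw => ?_⟩⟩⟩
  have hpS : ∀ s : N, Module.Dual.baseChange ℝ ((∑ s ∈ S, u s : dualSemigroup τ) :
      Module.Dual ℤ N) ((1 : ℝ) ⊗ₜ[ℤ] s) = ∑ r ∈ S, ((u r : Module.Dual ℤ N) s : ℝ) := fun s => by
    simp [Module.Dual.baseChange_apply_tmul]
  rw [hS] at hv
  have hnn : ∀ r s, s ∈ S → (0 : ℝ) ≤ ((u r : Module.Dual ℤ N) s : ℝ) := fun r s hs => by
    exact_mod_cast (mem_dualSemigroup_iff hS).1 (u r).2 s hs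
  refine eq_zero_of_mem_hull (f := Module.Dual.baseChange ℝ
    ((∑ s ∈ S, u s : dualSemigroup τ) : Module.Dual ℤ N))
    (g := Module.Dual.baseChange ℝ (w : Module.Dual ℤ N)) ?_ ?_ hv hv0
  · rintro _ ⟨s, hs, rfl⟩
    simp only [hpS]
    exact Finset.sum_nonneg fun r _ => hnn r s hs
  · rintro _ ⟨s, hs, rfl⟩ h
    simp only [hpS] at h
    by_cases hsσ : (1 : ℝ) ⊗ₜ[ℤ] s ∈ σ
    · exact ((hmem _).1 hsσ).2 w hw
    · have h2 := (Finset.sum_eq_zero_iff_of_nonneg fun r _ => hnn r s hs).1 h s hs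
      exact absurd (by exact_mod_cast h2) (hu' s hs hsσ)

/-- A point of `U_τ` whose orbit cone is `σ` comes from the orbit `O(σ) ⊆ U_σ`. -/
theorem exists_incl_orbitPoint_eq {τ : PointedCone ℝ (ℝ ⊗[ℤ] N)}
    (hτ : IsRationalPolyhedral τ) (hσ : IsRationalPolyhedral σ)
    (b : Module.Basis ι ℤ (QuotLattice σ)) (γ : AffineChart τ)
    (hγ : γ.orbitCone = σ) (h : σ ≤ τ) :
    ∃ x : ι → ℂˣ, (orbitPoint σ (torusOfCoords b x)).incl h = γ := by
  obtain ⟨p, hp, hpσ⟩ := exists_eval_ne_zero_of_orbitCone hτ γ hγ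
  have hloc : ∀ w ∈ perp σ, ∃ k : ℕ, w + k • (p : Module.Dual ℤ N) ∈ dualSemigroup τ :=
    fun w hw => exists_add_nsmul_mem_dualSemigroup hτ p.2 (fun v h1 h2 => (hpσ v).2 ⟨h1, h2⟩)
      (perp_le_dualSemigroup hw)
  have hperp : ∀ u : dualSemigroup τ, γ.eval u ≠ 0 → (u : Module.Dual ℤ N) ∈ perp σ := by
    intro u hu v hv
    rw [← SetLike.mem_coe, ← hγ] at hv
    exact hv.2 u hu
  have hne : ∀ u : dualSemigroup τ, (u : Module.Dual ℤ N) ∈ perp σ → γ.eval u ≠ 0 := by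
    intro u hu h0
    obtain ⟨k, hk⟩ := hloc _ (neg_mem hu)
    have h1 : u + ⟨_, hk⟩ = k • p := Subtype.ext (by simp)
    have h2 := γ.eval_add u ⟨_, hk⟩
    rw [h1, γ.eval_nsmul, h0, zero_mul] at h2
    exact pow_ne_zero k hp h2
  have hpp : (p : Module.Dual ℤ N) ∈ perp σ := hperp p hp
  -- The point extends to a character of the group $\sigma^\perp\cap M$ by
  -- $w\mapsto\gamma(w+kp)/\gamma(kp)$. Quantifying over all ways to write $w$ as a difference makes
  -- the choice of $k$ irrelevant.
  have hg : ∀ w : perp σ, ∃ c : ℂˣ, ∀ u v : dualSemigroup τ, (v : Module.Dual ℤ N) ∈ perp σ →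
      (w : Module.Dual ℤ N) + v = u → (c : ℂ) * γ.eval v = γ.eval u := by
    intro w
    obtain ⟨k, hk⟩ := hloc w w.2
    have h1 : γ.eval ⟨_, hk⟩ ≠ 0 := hne _ (add_mem w.2 (nsmul_mem hpp k))
    have h2 : γ.eval (k • p) ≠ 0 := by rw [γ.eval_nsmul]; exact pow_ne_zero k hp
    refine ⟨Units.mk0 (γ.eval ⟨_, hk⟩ / γ.eval (k • p)) (div_ne_zero h1 h2), fun u v hv huv => ?_⟩
    have h3 : (⟨_, hk⟩ : dualSemigroup τ) + v = u + k • p := Subtype.ext (by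
      simp only [AddSubmonoid.coe_add, AddSubmonoidClass.coe_nsmul, ← huv]
      abel)
    have h4 := congrArg γ.eval h3
    rw [γ.eval_add, γ.eval_add] at h4
    rw [Units.val_mk0, div_mul_eq_mul_div, h4, mul_div_assoc, div_self h2, mul_one]
  choose c hc using hg
  have hc_add : ∀ w w', c (w + w') = c w * c w' := by
    intro w w'
    obtain ⟨k, hk⟩ := hloc w w.2
    obtain ⟨k', hk'⟩ := hloc w' w'.2
    have hk1 : ∀ k : ℕ, ((k • p : dualSemigroup τ) : Module.Dual ℤ N) ∈ perp σ := fun k =>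
      nsmul_mem hpp k
    have h1 := hc w ⟨_, hk⟩ (k • p) (hk1 k) rfl
    have h2 := hc w' ⟨_, hk'⟩ (k' • p) (hk1 k') rfl
    have h3 := hc (w + w') (⟨_, hk⟩ + ⟨_, hk'⟩) (k • p + k' • p) (add_mem (hk1 k) (hk1 k')) (by
      simp only [AddSubmonoid.coe_add, AddSubmonoidClass.coe_nsmul, AddSubgroup.coe_add]
      abel)
    rw [γ.eval_add, γ.eval_add, ← h1, ← h2] at h3
    have h4 : γ.eval (k • p) * γ.eval (k' • p) ≠ 0 := mul_ne_zero (hne _ (hk1 k)) (hne _ (hk1 k'))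
    refine Units.ext (mul_right_cancel₀ h4 ?_)
    rw [h3, Units.val_mul]
    ring
  obtain ⟨x, hx⟩ := exists_torusOfCoords_of_hom b
    (fun u => c ⟨_, mkQ_comp_mem_perp hσ u⟩) (fun u u' => by
      rw [← hc_add]
      exact congrArg c (Subtype.ext (LinearMap.add_comp _ _ _)))
  refine ⟨x, ?_⟩
  ext u
  by_cases hu : (u : Module.Dual ℤ N) ∈ perp σ
  · refine (orbitPoint_eval _ (u := AddSubmonoid.inclusion (dualSemigroup_anti h) u) hu).trans ?_
    have h1 := hc ⟨u, hu⟩ u 0 (zero_mem _) (by simp)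
    rw [γ.eval_zero, mul_one] at h1
    rw [← h1, ← hx]
    exact congrArg (fun w => (c w : ℂ)) (Subtype.ext (descend_comp_mkQ hu))
  · refine (orbitPoint_eval_of_notMem _ (u := AddSubmonoid.inclusion (dualSemigroup_anti h) u)
      hu).trans ?_
    by_contra h0
    exact hu (hperp u (Ne.symm h0))

end OrbitPoints

end Points

/-! ### Separating points of the glued variety; fibres of $\Phi_m$. -/

namespace Fan

variable {N : Type*} [AddCommGroup N] (F : Fan N)

/-- The quotient is by the equivalence relation generated by gluing, whose chains are not controlled
directly. Functions constant on single gluings descend to the quotient and distinguish points there.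
-/
theorem Glue.ratioGraph_eq_and_orbitCone_eq [Module.Finite ℤ N] {F : Fan N}
    {x y : Σ σ : F.cones, AffineChart (σ : PointedCone ℝ (ℝ ⊗[ℤ] N))} (h : F.Glue x y) :
    x.2.ratioGraph = y.2.ratioGraph ∧ x.2.orbitCone = y.2.orbitCone := by
  obtain ⟨δ, h1, h2⟩ := h
  obtain ⟨hf1, hf2⟩ := F.inter_face _ x.1.2 _ y.1.2
  obtain ⟨p, hp, hp'⟩ := hf1.exists_integral (F.rational _ x.1.2)
  obtain ⟨q, hq, hq'⟩ := hf2.exists_integral (F.rational _ y.1.2)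
  rw [← h1, ← h2, ratioGraph_incl (F.rational _ x.1.2) hp hp',
    ratioGraph_incl (F.rational _ y.1.2) hq hq', orbitCone_incl (F.rational _ x.1.2) hp hp',
    orbitCone_incl (F.rational _ y.1.2) hq hq']
  exact ⟨rfl, rfl⟩

theorem chart_injective [Module.Finite ℤ N] (σ : F.cones) :
    Function.Injective (F.chart σ) := fun _ _ h =>
  AffineChart.eq_of_ratioGraph_eq (congrArg
    (Quot.lift (r := F.Glue) (fun x => x.2.ratioGraph)
      fun _ _ h => h.ratioGraph_eq_and_orbitCone_eq.1) h)

theorem orbitCone_eq_of_chart_eq [Module.Finite ℤ N] {σ τ : F.cones}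
    {γ : AffineChart (σ : PointedCone ℝ (ℝ ⊗[ℤ] N))}
    {γ' : AffineChart (τ : PointedCone ℝ (ℝ ⊗[ℤ] N))} (h : F.chart σ γ = F.chart τ γ') :
    γ.orbitCone = γ'.orbitCone :=
  congrArg
    (Quot.lift (r := F.Glue) (fun x => x.2.orbitCone)
      fun _ _ h => h.ratioGraph_eq_and_orbitCone_eq.2) h

theorem chart_incl {σ τ : F.cones} (h : (σ : PointedCone ℝ (ℝ ⊗[ℤ] N)) ≤ τ)
    (δ : AffineChart (σ : PointedCone ℝ (ℝ ⊗[ℤ] N))) :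
    F.chart τ (δ.incl h) = F.chart σ δ :=
  Quot.sound
    ⟨AffineChart.incl (σ := (τ : PointedCone ℝ (ℝ ⊗[ℤ] N)) ⊓ σ) (le_inf h le_rfl) δ, rfl, rfl⟩

variable {ι : Type*} [Fintype ι]

/-- The point of the orbit `O(σ)` with given coordinates. -/
noncomputable def coordPoint (σ : F.cones)
    (b : Module.Basis ι ℤ (QuotLattice (σ : PointedCone ℝ (ℝ ⊗[ℤ] N)))) (x : ι → ℂˣ) : F.Variety :=
  F.chart σ (orbitPoint (σ : PointedCone ℝ (ℝ ⊗[ℤ] N)) (torusOfCoords b x))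

variable {F} {σ : F.cones} (b : Module.Basis ι ℤ (QuotLattice (σ : PointedCone ℝ (ℝ ⊗[ℤ] N))))

theorem coordPoint_injective [Module.Finite ℤ N] : Function.Injective (F.coordPoint σ b) :=
  (F.chart_injective σ).comp (orbitPoint_torusOfCoords_injective (F.rational _ σ.2) b)

theorem continuous_coordPoint : Continuous (F.coordPoint σ b) :=
  (continuous_quot_mk.comp continuous_sigmaMk).comp (continuous_orbitPoint_torusOfCoords b)

theorem exists_coordPoint_of_mem_orbit {z : F.Variety} (hz : z ∈ F.orbit σ) :
    ∃ x, F.coordPoint σ b x = z := by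
  obtain ⟨t, rfl⟩ := hz
  obtain ⟨x, hx⟩ := torusOfCoords_surjective (G := ℂˣ) b
    ((latticeSpan (σ : PointedCone ℝ (ℝ ⊗[ℤ] N))).mkQ.lTensor (Additive ℂˣ) t)
  refine ⟨x, ?_⟩
  rw [coordPoint, hx, orbitPoint_mk]
  rfl

theorem multEnd_coordPoint {m : ℕ} (hm : m ≠ 0) (x : ι → ℂˣ) :
    F.multEnd m (F.coordPoint σ b x) = F.coordPoint σ b (x ^ m) :=
  congrArg (F.chart σ) (mapEnd_orbitPoint m hm b x _)

/-- The fibres of `Φ_m` over the points of an orbit. -/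
theorem multEnd_eq_coordPoint_iff [Module.Finite ℤ N] {m : ℕ} (hm : m ≠ 0) (x : ι → ℂˣ)
    (a : F.Variety) :
    F.multEnd m a = F.coordPoint σ b x ↔ ∃ y, y ^ m = x ∧ F.coordPoint σ b y = a := by
  constructor
  · intro h
    obtain ⟨⟨τ, γ⟩, rfl⟩ := Quot.exists_rep a
    have h1 : F.chart τ (γ.mapEnd (m • LinearMap.id) fun v hv => multiplication_mem m τ v hv)
        = F.chart σ (orbitPoint (σ : PointedCone ℝ (ℝ ⊗[ℤ] N)) (torusOfCoords b x)) := h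
    -- Neither $\Phi_m$ nor a change of chart alters the orbit cone, so that of $a$ is $\sigma$;
    -- hence $\sigma\subseteq\tau$ and $a$ comes from $\mathcal O(\sigma)$.
    have h2 := F.orbitCone_eq_of_chart_eq h1
    rw [orbitCone_mapEnd m hm, orbitCone_orbitPoint] at h2
    have h3 : (σ : PointedCone ℝ (ℝ ⊗[ℤ] N)) ≤ τ := fun v hv => by
      rw [← SetLike.mem_coe, ← h2] at hv
      exact hv.1
    obtain ⟨y, rfl⟩ := exists_incl_orbitPoint_eq (F.rational _ τ.2) (F.rational _ σ.2) b γ h2 h3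
    have h4 : F.coordPoint σ b y = Quot.mk _ ⟨τ, AffineChart.incl h3 _⟩ := (F.chart_incl h3 _).symm
    rw [← h4, multEnd_coordPoint b hm] at h
    exact ⟨y, coordPoint_injective b h, h4⟩
  · rintro ⟨y, rfl, rfl⟩
    exact multEnd_coordPoint b hm y

theorem compactPoint_torusOfCoords (c : ι → Circle) :
    F.compactPoint σ (torusOfCoords b c) = F.coordPoint σ b fun i => Circle.toUnits (c i) := by
  simp only [compactPoint, coordPoint]
  rw [compactToComplex_torusOfCoords]

end Fan

/-! ### Equidistribution of $m$-th roots in a torus. -/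

section Equidistribution

variable {ι : Type*}

/-- The coordinatewise exponential map `ℂ^ι → (ℂ^*)^ι`. -/
noncomputable def expUnits (a : ι → ℂ) : ι → ℂˣ := fun i =>
  Units.mk0 (Complex.exp (a i)) (Complex.exp_ne_zero _)

theorem continuous_expUnits : Continuous (expUnits (ι := ι)) := by
  refine continuous_pi fun i => Units.isEmbedding_val₀.continuous_iff.2 ?_
  exact Complex.continuous_exp.comp (continuous_apply i)

theorem expUnits_zero : expUnits (0 : ι → ℂ) = 1 := by
  ext i
  simp [expUnits]

/-- The coordinatewise principal `m`-th root. -/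
noncomputable def principalRoot (m : ℕ) (x : ι → ℂˣ) : ι → ℂˣ :=
  expUnits fun i => Complex.log (x i) / m

theorem principalRoot_pow {m : ℕ} (hm : m ≠ 0) (x : ι → ℂˣ) : principalRoot m x ^ m = x := by
  have h0 : (m : ℂ) ≠ 0 := by exact_mod_cast hm
  ext i
  simp only [principalRoot, expUnits, Pi.pow_apply, Units.val_pow_eq_pow_val, Units.val_mk0]
  rw [← Complex.exp_nat_mul, mul_div_cancel₀ _ h0, Complex.exp_log (x i).ne_zero]

/-- Translation by a small element of `(ℂ^*)^ι` changes a continuous function little, uniformly on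
the compact torus. -/
theorem exists_forall_abs_sub_lt (G : C(ι → ℂˣ, ℝ)) [Fintype ι] {ε : ℝ} (hε : 0 < ε) :
    ∃ δ > 0, ∀ a : ι → ℂ, ‖a‖ < δ → ∀ c : ι → Circle,
      |G (expUnits a * fun i => Circle.toUnits (c i)) - G fun i => Circle.toUnits (c i)| < ε := by
  have hu : Continuous Circle.toUnits :=
    Units.isEmbedding_val₀.continuous_iff.2 continuous_subtype_val
  let H : C((ι → ℂ) × (ι → Circle), ℝ) :=
    ⟨fun y => G (expUnits y.1 * fun i => Circle.toUnits (y.2 i)), G.continuous.comp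
      ((continuous_expUnits.comp continuous_fst).mul
        (continuous_pi fun i => hu.comp ((continuous_apply i).comp continuous_snd)))⟩
  -- The compact torus is compact, so currying gives a continuous map into functions with the sup
  -- metric; its continuity at $0$ is the uniform estimate.
  obtain ⟨δ, hδ, h⟩ := Metric.continuous_iff.1 H.curry.continuous 0 ε hε
  refine ⟨δ, hδ, fun a ha c => ?_⟩
  have h1 := (ContinuousMap.dist_apply_le_dist c).trans_lt (h a (by simpa using ha))
  simpa [H, Real.dist_eq, expUnits_zero] using h1

instance {L : Type*} [AddCommGroup L] [Module.Finite ℤ L] :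
    IsProbabilityMeasure (haarCompactTorus L) :=
  ⟨by simpa [haarCompactTorus] using
    Measure.addHaarMeasure_self (K₀ := (⊤ : TopologicalSpace.PositiveCompacts (CompactTorus L)))⟩

instance {L : Type*} [AddCommGroup L] [Module.Finite ℤ L] :
    (haarCompactTorus L).IsAddLeftInvariant :=
  inferInstanceAs (Measure.addHaarMeasure _).IsAddLeftInvariant

/-- The complex `m`-th roots of unity as points of the unit circle. -/
noncomputable def rootsToCircle (m : ℕ) [NeZero m] (ζ : ι → rootsOfUnity m ℂ) : ι → Circle :=
  fun i => (((rootsOfUnityCircleEquiv m).symm (ζ i) : rootsOfUnity m Circle) : Circleˣ)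

theorem toUnits_rootsToCircle (m : ℕ) [NeZero m] (ζ : ι → rootsOfUnity m ℂ) (i : ι) :
    Circle.toUnits (rootsToCircle m ζ i) = (ζ i : ℂˣ) := by
  ext
  have := rootsOfUnityCircleEquiv_apply m ((rootsOfUnityCircleEquiv m).symm (ζ i))
  rw [MulEquiv.apply_symm_apply] at this
  exact this.symm

/-- A point of the compact torus is the product of an `m`-torsion point and the principal `m`-th
root of a point of the compact torus. -/
theorem exists_eq_principalRoot_mul_root (m : ℕ) [NeZero m] (c : ι → Circle) :
    ∃ (θ : ι → ℝ) (ζ : ι → rootsOfUnity m ℂ), (∀ i, |θ i| ≤ Real.pi) ∧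
      (fun i => Circle.toUnits (c i))
        = (expUnits fun i => (θ i : ℂ) * Complex.I / m) * fun i => (ζ i : ℂˣ) := by
  have h0 : (m : ℂ) ≠ 0 := by exact_mod_cast NeZero.ne m
  let x : ι → ℂˣ := fun i => Circle.toUnits (c i)
  let y := principalRoot m (x ^ m)
  have hy : y ^ m = x ^ m := principalRoot_pow (NeZero.ne m) _
  have hz : ∀ i, x i / y i ∈ rootsOfUnity m ℂ := fun i => by
    rw [mem_rootsOfUnity, div_pow, ← Pi.pow_apply y, hy]
    exact div_self' _
  refine ⟨fun i => Complex.arg ((c i : ℂ) ^ m), fun i => ⟨_, hz i⟩,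
    fun i => Complex.abs_arg_le_pi _, ?_⟩
  have h1 : (expUnits fun i => ((Complex.arg ((c i : ℂ) ^ m) : ℝ) : ℂ) * Complex.I / m) = y := by
    simp only [y, principalRoot]
    congr 1
    funext i
    congr 1
    apply Complex.ext <;> simp [x, Complex.log_re, Complex.log_im, Circle.norm_coe]
  rw [h1]
  funext i
  simp [x]

variable {L : Type*} [AddCommGroup L] [Module.Finite ℤ L] [Fintype ι]

/-- Equidistribution of the `m`-th roots of a point of `(ℂ^*)^ι` towards the Haar measure of the
compact torus. -/
theorem eventually_abs_average_sub_integral_le (b : Module.Basis ι ℤ L) (G : C(ι → ℂˣ, ℝ))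
    {g : CompactTorus L → ℝ} (hg : Continuous g)
    (hgG : ∀ c : ι → Circle, g (torusOfCoords b c) = G fun i => Circle.toUnits (c i))
    (x : ι → ℂˣ) {ε : ℝ} (hε : 0 < ε) :
    ∀ᶠ m : ℕ in atTop, ∀ [NeZero m] [Fintype (ι → rootsOfUnity m ℂ)],
      |((m : ℝ) ^ Fintype.card ι)⁻¹ *
          ∑ ζ : ι → rootsOfUnity m ℂ, G (principalRoot m x * fun i => (ζ i : ℂˣ))
        - ∫ s, g s ∂haarCompactTorus L| ≤ ε := by
  obtain ⟨δ, hδ, hδG⟩ := exists_forall_abs_sub_lt G (half_pos hε)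
  -- $R$ bounds both the logarithms of the coordinates of $x$ and all arguments (at most $\pi$);
  -- dividing by $m>R/\delta$ makes both perturbations smaller than $\delta$.
  let R : ℝ := ‖fun i => Complex.log (x i)‖ + Real.pi
  have hR : 0 ≤ R := add_nonneg (norm_nonneg _) Real.pi_pos.le
  obtain ⟨M, hM⟩ := exists_nat_gt (R / δ)
  refine eventually_atTop.2 ⟨M, fun m hm _ _ => ?_⟩
  have hm0 : (0 : ℝ) < m := by exact_mod_cast NeZero.pos m
  have hRm : R / m < δ := by
    rw [div_lt_iff₀ hm0]
    have h1 : R / δ < m := hM.trans_le (by exact_mod_cast hm)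
    rwa [div_lt_iff₀ hδ, mul_comm] at h1
  have hsmall : ∀ a : ι → ℂ, (∀ i, ‖a i‖ ≤ R) → ‖fun i => a i / (m : ℂ)‖ < δ := by
    intro a ha
    refine lt_of_le_of_lt ((pi_norm_le_iff_of_nonneg (by positivity)).2 fun i => ?_) hRm
    rw [norm_div, Complex.norm_natCast]
    gcongr
    exact ha i
  have hxa := hδG _ (hsmall (fun i => Complex.log (x i)) fun i =>
    (norm_le_pi_norm (fun i => Complex.log (x i)) i).trans
      (le_add_of_nonneg_right Real.pi_pos.le))
  let μ := haarCompactTorus L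
  let p : (ι → rootsOfUnity m ℂ) → CompactTorus L := fun ζ => torusOfCoords b (rootsToCircle m ζ)
  have hcard : (Fintype.card (ι → rootsOfUnity m ℂ) : ℝ) = (m : ℝ) ^ Fintype.card ι := by
    rw [Fintype.card_eq_nat_card, Nat.card_fun, Complex.card_rootsOfUnity, Nat.card_eq_fintype_card,
      Nat.cast_pow]
  have hint : ∀ f : CompactTorus L → ℝ, Continuous f → Integrable f μ := fun f hf =>
    (BoundedContinuousFunction.mkOfCompact ⟨f, hf⟩).integrable μ
  have hcont : ∀ ζ, Continuous fun s => g (p ζ + s) := fun ζ =>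
    hg.comp (continuous_const.add continuous_id)
  have hpow : (m : ℝ) ^ Fintype.card ι ≠ 0 := by positivity
  -- By translation invariance each $g(p_\zeta+s)$ has the same integral as $g$, so $D$ integrates
  -- to the quantity to be estimated. It then suffices to bound $D$ pointwise.
  let D : CompactTorus L → ℝ := fun s => ((m : ℝ) ^ Fintype.card ι)⁻¹ *
    ∑ ζ : ι → rootsOfUnity m ℂ,
      (G (principalRoot m x * fun i => (ζ i : ℂˣ)) - g (p ζ + s))
  have hD : ∫ s, D s ∂μ = ((m : ℝ) ^ Fintype.card ι)⁻¹ *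
          ∑ ζ : ι → rootsOfUnity m ℂ, G (principalRoot m x * fun i => (ζ i : ℂˣ))
        - ∫ s, g s ∂μ := by
    have hterm : ∀ ζ : ι → rootsOfUnity m ℂ,
        ∫ s, (G (principalRoot m x * fun i => (ζ i : ℂˣ)) - g (p ζ + s)) ∂μ
          = G (principalRoot m x * fun i => (ζ i : ℂˣ)) - ∫ s, g s ∂μ := fun ζ => by
      rw [integral_sub (integrable_const _) (hint _ (hcont ζ)),
        integral_add_left_eq_self (μ := haarCompactTorus L) g (p ζ)]
      simp [μ]
    simp only [D]
    rw [integral_const_mul, integral_finsetSum _ fun ζ _ => (hint _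
      (continuous_const.sub (hcont ζ)) :
        Integrable (fun s => G (principalRoot m x * fun i => (ζ i : ℂˣ)) - g (p ζ + s)) μ)]
    simp_rw [hterm]
    rw [Finset.sum_sub_distrib, mul_sub]
    simp only [Finset.sum_const, Finset.card_univ, nsmul_eq_mul, hcard]
    rw [inv_mul_cancel_left₀ hpow]
  rw [← hD, ← Real.norm_eq_abs]
  refine (norm_integral_le_of_norm_le_const (C := ε) (Eventually.of_forall fun s => ?_)).trans ?_
  · obtain ⟨c, hcs⟩ := torusOfCoords_surjective (G := Circle) b s
    obtain ⟨θ, ξ, hθ, hc⟩ := exists_eq_principalRoot_mul_root m c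
    have hya := hδG _ (hsmall (fun i => (θ i : ℂ) * Complex.I) fun i => by
      simpa using (hθ i).trans (le_add_of_nonneg_left (norm_nonneg _)))
    have hgp : ∀ ζ : ι → rootsOfUnity m ℂ, g (p ζ + s)
        = G ((expUnits fun i => (θ i : ℂ) * Complex.I / m) *
          fun i => Circle.toUnits (rootsToCircle m (ζ * ξ) i)) := by
      intro ζ
      have h1 : p ζ + s = torusOfCoords b (rootsToCircle m ζ * c) := by
        rw [← hcs]
        exact (torusOfCoords_mul b _ _).symm
      rw [h1, hgG]
      congr 1
      funext i
      have h2 := congrFun hc i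
      simp only [Pi.mul_apply, map_mul] at h2 ⊢
      rw [h2, toUnits_rootsToCircle, toUnits_rootsToCircle, Pi.mul_apply, Subgroup.coe_mul]
      exact mul_left_comm _ _ _
    -- The torsion part $\xi$ of $s$ is absorbed by reindexing. Both sums then run over small
    -- perturbations of the same torsion points, each costing at most $\varepsilon/2$ per term.
    have hsum : ∑ ζ, g (p ζ + s)
        = ∑ ζ : ι → rootsOfUnity m ℂ, G ((expUnits fun i => (θ i : ℂ) * Complex.I / m) *
          fun i => Circle.toUnits (rootsToCircle m ζ i)) := by
      simp_rw [hgp]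
      exact Equiv.sum_comp (Equiv.mulRight ξ) fun ζ : ι → rootsOfUnity m ℂ =>
        G ((expUnits fun i => (θ i : ℂ) * Complex.I / m) *
          fun i => Circle.toUnits (rootsToCircle m ζ i))
    simp only [D]
    rw [Finset.sum_sub_distrib, hsum, ← Finset.sum_sub_distrib, norm_mul, norm_inv,
      Real.norm_of_nonneg (by positivity : (0 : ℝ) ≤ (m : ℝ) ^ Fintype.card ι),
      inv_mul_le_iff₀ (by positivity), ← hcard]
    refine (norm_sum_le_of_le (f := fun ζ => _) _ (n := fun _ => ε) fun ζ _ => ?_).trans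
      (by simp [Finset.card_univ])
    have h1 := hxa (rootsToCircle m ζ)
    have h2 := hya (rootsToCircle m ζ)
    have h3 : (fun i => (ζ i : ℂˣ)) = fun i => Circle.toUnits (rootsToCircle m ζ i) :=
      funext fun i => (toUnits_rootsToCircle m ζ i).symm
    rw [h3, Real.norm_eq_abs, abs_le]
    rw [abs_lt] at h1 h2
    simp only [principalRoot]
    constructor <;> linarith [h1.1, h1.2, h2.1, h2.2]
  · simp

end Equidistribution

/-- Weak convergence is the convergence of the integrals of bounded continuous functions. -/
theorem weaklyConverges_of_forall_integral {X : Type*} [MeasurableSpace X] [TopologicalSpace X]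
    [OpensMeasurableSpace X] {μs : ℕ → Measure X} {μ : Measure X} [IsFiniteMeasure μ]
    (hfin : ∀ᶠ m in atTop, IsFiniteMeasure (μs m))
    (h : ∀ f : BoundedContinuousFunction X ℝ,
      Tendsto (fun m => ∫ x, f x ∂μs m) atTop (𝓝 (∫ x, f x ∂μ))) :
    WeaklyConverges μs μ := by
  have hex : ∀ m, ∃ ν : FiniteMeasure X, IsFiniteMeasure (μs m) → (ν : Measure X) = μs m := by
    intro m
    by_cases hm : IsFiniteMeasure (μs m)
    · exact ⟨⟨μs m, hm⟩, fun _ => rfl⟩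
    · exact ⟨0, fun h => absurd h hm⟩
  choose νs hνs using hex
  have heq : ∀ᶠ m in atTop, (νs m : Measure X) = μs m := hfin.mono hνs
  refine ⟨νs, ⟨μ, inferInstance⟩, heq, rfl,
    FiniteMeasure.tendsto_iff_forall_integral_tendsto.2 fun f => ?_⟩
  refine (h f).congr' ?_
  filter_upwards [heq] with m hm
  rw [hm]

/-! ### The pulled-back Dirac measure and the conclusion. -/

namespace Fan

variable {N : Type*} [AddCommGroup N] {F : Fan N} {σ : F.cones} {ι : Type*} [Fintype ι]
  (b : Module.Basis ι ℤ (QuotLattice (σ : PointedCone ℝ (ℝ ⊗[ℤ] N))))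

/-- The pullback of a Dirac measure at a point of an orbit is a sum over roots of unity. -/
theorem pullbackDirac_multEnd [Module.Finite ℤ N] (m : ℕ) [NeZero m]
    [Fintype (ι → rootsOfUnity m ℂ)] (x : ι → ℂˣ) :
    pullbackDirac (F.multEnd m) (F.coordPoint σ b x)
      = ∑ ζ : ι → rootsOfUnity m ℂ,
        Measure.dirac (F.coordPoint σ b (principalRoot m x * fun i => (ζ i : ℂˣ))) := by
  have hroot : ∀ ζ : ι → rootsOfUnity m ℂ,
      (principalRoot m x * fun i => (ζ i : ℂˣ)) ^ m = x := fun ζ => by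
    rw [mul_pow, principalRoot_pow (NeZero.ne m)]
    funext i
    simp [(mem_rootsOfUnity m _).1 (ζ i).2]
  let e : (ι → rootsOfUnity m ℂ) ≃ F.multEnd m ⁻¹' {F.coordPoint σ b x} :=
    Equiv.ofBijective (fun ζ => ⟨F.coordPoint σ b (principalRoot m x * fun i => (ζ i : ℂˣ)),
      (multEnd_eq_coordPoint_iff b (NeZero.ne m) x _).2 ⟨_, hroot ζ, rfl⟩⟩) (by
    constructor
    · intro ζ ξ h
      have h1 := mul_left_cancel (coordPoint_injective b (Subtype.ext_iff.1 h))
      funext i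
      exact Subtype.ext (congrFun h1 i)
    · rintro ⟨a, ha⟩
      obtain ⟨y, hy, rfl⟩ := (multEnd_eq_coordPoint_iff b (NeZero.ne m) x a).1 ha
      refine ⟨fun i => ⟨y i / principalRoot m x i, ?_⟩, Subtype.ext (congrArg (F.coordPoint σ b) ?_)⟩
      · rw [mem_rootsOfUnity, div_pow, ← Pi.pow_apply y, ← Pi.pow_apply (principalRoot m x), hy,
          principalRoot_pow (NeZero.ne m)]
        exact div_self' _
      · funext i
        simp)
  have : Fintype (F.multEnd m ⁻¹' {F.coordPoint σ b x}) := Fintype.ofEquiv _ e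
  rw [pullbackDirac, Measure.sum_fintype, ← e.sum_comp]
  rfl

instance [Module.Finite ℤ N] : IsProbabilityMeasure (F.haarDistinguished σ) :=
  Measure.isProbabilityMeasure_map (F.continuous_compactPoint σ).measurable.aemeasurable

end Fan

end Toric

theorem mainTheorem6 {N : Type*} [AddCommGroup N] [Module.Free ℤ N] [Module.Finite ℤ N]
    (F : Toric.Fan N) (σ : F.cones) (z : F.Variety) (hz : z ∈ F.orbit σ) :
    Toric.WeaklyConverges
      (fun m : ℕ =>
        ((m : ℝ≥0) ^ ((Toric.coneDim (σ : PointedCone ℝ (ℝ ⊗[ℤ] N)) : ℤ)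
            - (Module.finrank ℤ N : ℤ))) • Toric.pullbackDirac (F.multEnd m) z)
      (F.haarDistinguished σ) := by
  classical
  have hrat := F.rational _ σ.2
  have := Toric.quotLattice_free hrat
  let b := Module.finBasis ℤ (Toric.QuotLattice (σ : PointedCone ℝ (ℝ ⊗[ℤ] N)))
  obtain ⟨x, rfl⟩ := Toric.Fan.exists_coordPoint_of_mem_orbit b hz
  have hexp : (Toric.coneDim (σ : PointedCone ℝ (ℝ ⊗[ℤ] N)) : ℤ) - (Module.finrank ℤ N : ℤ)
      = -(Module.finrank ℤ (Toric.QuotLattice (σ : PointedCone ℝ (ℝ ⊗[ℤ] N))) : ℤ) := by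
    have := Toric.finrank_quotLattice_add_coneDim hrat
    omega
  rw [hexp]
  simp only [zpow_neg, zpow_natCast]
  refine Toric.weaklyConverges_of_forall_integral ?_ fun f => ?_
  · filter_upwards [eventually_ne_atTop 0] with m hm
    have : NeZero m := ⟨hm⟩
    have := Fintype.ofFinite (Fin (Module.finrank ℤ (Toric.QuotLattice
      (σ : PointedCone ℝ (ℝ ⊗[ℤ] N)))) → rootsOfUnity m ℂ)
    rw [Toric.Fan.pullbackDirac_multEnd]
    infer_instance
  · have hmap : ∫ y, f y ∂F.haarDistinguished σ
        = ∫ s, f (F.compactPoint σ s) ∂Toric.haarCompactTorus _ :=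
      integral_map (F.continuous_compactPoint σ).measurable.aemeasurable
        f.continuous.measurable.aestronglyMeasurable
    -- This form of the criterion asks for $m>M$ strictly, which also gives $m\neq 0$.
    rw [hmap, Metric.tendsto_atTop']
    intro ε hε
    have h := Toric.eventually_abs_average_sub_integral_le b
      ⟨fun y => f (F.coordPoint σ b y),
        f.continuous.comp (Toric.Fan.continuous_coordPoint b)⟩
      (f.continuous.comp (F.continuous_compactPoint σ))
      (fun c => congrArg f (Toric.Fan.compactPoint_torusOfCoords b c)) x (half_pos hε)
    obtain ⟨M, hM⟩ := eventually_atTop.1 h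
    refine ⟨M, fun m hm => ?_⟩
    have : NeZero m := ⟨by omega⟩
    have := Fintype.ofFinite (Fin (Module.finrank ℤ (Toric.QuotLattice
      (σ : PointedCone ℝ (ℝ ⊗[ℤ] N)))) → rootsOfUnity m ℂ)
    have h1 := hM m (le_of_lt hm)
    rw [Toric.Fan.pullbackDirac_multEnd, integral_smul_nnreal_measure,
      integral_finsetSum_measure fun ζ _ => f.integrable _]
    simp_rw [integral_dirac' _ _ f.continuous.measurable.stronglyMeasurable]
    rw [Real.dist_eq]
    rw [Fintype.card_fin] at h1
    refine lt_of_le_of_lt ?_ (half_lt_self hε)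
    rw [NNReal.smul_def, smul_eq_mul, NNReal.coe_inv, NNReal.coe_pow, NNReal.coe_natCast]
    exact h1
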